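/- Let $\mathbb{F}_q$ be a finite field with $q$ elements, $k=\mathbb{F}_q(\theta)$, $k_\infty=\mathbb{F}_q((1/\theta))$ its completion at the infinite place, $\mathbb{K}$ the completion of an algebraic closure of $k_\infty$ with respect to the unique extension $|\cdot|_\infty$ of the $\infty$-adic absolute value, and $\overline{k}$ the algebraic closure of $k$ in $\mathbb{K}$. Let $\mathbb{T}\subseteq\mathbb{K}[[t]]$ be the ring of power series $\sum_i a_it^i$ with $|a_i|_\infty\to 0$, and $\mathbb{L}$ its fraction field, so that $\mathbb{F}_q(t)\subseteq\overline{k}(t)\subseteq\mathbb{L}$. Let $\sigma$ be the automorphism of $\mathbb{L}$ induced by $\sum_i a_it^i\mapsto\sum_i a_i^{1/q}t^i$ on $\mathbb{T}$; it preserves $\overline{k}(t)$ and fixes $\mathbb{F}_q(t)$ elementwise. A pre-$t$-motive is a left module over the skew Laurent polynomial ring $\overline{k}(t)[\boldsymbol{\sigma},\boldsymbol{\sigma}^{-1}]$ (with $\boldsymbol{\sigma}f=\sigma(f)\boldsymbol{\sigma}$ for $f\in\overline{k}(t)$) that is finite dimensional over $\overline{k}(t)$; equivalently, a finite-dimensional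 $\overline{k}(t)$-vector space with a bijective $\sigma$-semilinear operator $\boldsymbol{\sigma}$. Morphisms are module homomorphisms. These form an $\mathbb{F}_q(t)$-linear category $\mathcal{P}$, which is a symmetric tensor category under $P\otimes Q=P\otimes_{\overline{k}(t)}Q$ with $\boldsymbol{\sigma}(m\otimes n)=\boldsymbol{\sigma}m\otimes\boldsymbol{\sigma}n$, the usual associativity and commutativity isomorphisms, and identity object $\mathbf{1}=\overline{k}(t)$ with $\boldsymbol{\sigma}f=\sigma(f)$. For $P$ in $\mathcal{P}$ put $P^\dagger=\mathbb{L}\otimes_{\overline{k}(t)}P$ with $\boldsymbol{\sigma}(f\otimes m)=\sigma(f)\otimes\boldsymbol{\sigma}m$, and let $P^{\mathrm{B}}=\{\mu\in P^\dagger:\boldsymbol{\sigma}\mu=\mu\}$, an $\mathbb{F}_q(t)$-vector space, functorial in $P$. Call $P$ rigid analytically trivial if the natural map $\mathbb{L}\otimes_{\mathbb{F}_q(t)}P^{\mathrm{B}}\to P^\dagger$ is an isomorphism, and let $\mathcal{R}$ be the full subcategory of $\mathcal{P}$ of rigid analytically trivial objects. **Theorem.** The category $\mathcal{R}$ is a neutral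 Tannakian category over $\mathbb{F}_q(t)$ with fiber functor $P\mapsto P^{\mathrm{B}}$ from $\mathcal{R}$ to finite-dimensional $\mathbb{F}_q(t)$-vector spaces. That is: 1. $\mathcal{R}$ contains $\mathbf{1}$ and is closed under tensor products in $\mathcal{P}$; with the tensor structure inherited from $\mathcal{P}$ it is a rigid (every object has a dual) abelian tensor category with $\mathbb{F}_q(t)$-bilinear tensor product, and $\mathbb{F}_q(t)\to\operatorname{End}_{\mathcal{R}}(\mathbf{1})$ is an isomorphism; 2. $P\mapsto P^{\mathrm{B}}$ is an exact, faithful, $\mathbb{F}_q(t)$-linear tensor functor (compatible with the associativity, commutativity and unit constraints), whose tensor isomorphisms $P^{\mathrm{B}}\otimes_{\mathbb{F}_q(t)}Q^{\mathrm{B}}\to(P\otimes Q)^{\mathrm{B}}$ are the natural maps induced by $(f\otimes m)\otimes(g\otimes n)\mapsto fg\otimes(m\otimes n)$. -/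

import Mathlib

open CategoryTheory MonoidalCategory TensorProduct Polynomial

universe u

noncomputable section

namespace TMotive

/-! ### The fields `k_∞ ⊆ 𝕂` and the `q`-th root automorphism

Throughout, `F` is a finite field with `q` elements, `RatFunc F` with variable `θ` is `k`, and
`RatFunc F` with variable `t` is the field of constants `𝔽_q(t)`.  To keep the two roles apart, no
`RatFunc F`-algebra structure is put on the fields containing `θ`; the inclusion of `k = 𝔽_q(θ)` is
the ring homomorphism `ratToCInf`. -/

open scoped Classical in
/-- `k_∞ = 𝔽_q((1/θ))`, the completion of `𝔽_q(θ)` at the place at infinity. -/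
def kInf (F : Type u) [Field F] : Type u := RatFunc.CompletionAtInfty F

section Constants

variable (F : Type u) [Field F]

open scoped Classical in
instance : Field (kInf F) := inferInstanceAs (Field (RatFunc.CompletionAtInfty F))

open scoped Classical in
instance : Valued (kInf F) (WithZero (Multiplicative ℤ)) :=
  inferInstanceAs (Valued (RatFunc.CompletionAtInfty F) _)

open scoped Classical in
instance : CompleteSpace (kInf F) := by
  let _ := RatFunc.inftyValued F
  exact inferInstanceAs (CompleteSpace (UniformSpace.Completion (RatFunc F)))

open scoped Classical in
/-- The inclusion `k → k_∞`. -/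
def ratToKInf : RatFunc F →+* kInf F := algebraMap (RatFunc F) (RatFunc.CompletionAtInfty F)

open scoped Classical in
theorem v_ratToKInf (x : RatFunc F) : Valued.v (ratToKInf F x) = RatFunc.inftyValuation F x := by
  let _ := RatFunc.inftyValued F
  exact Valued.extensionValuation_apply_coe (K := RatFunc F) x

variable [Fintype F]

/-- The `∞`-adic valuation on `k_∞` is turned into a real absolute value with `|θ| = q`. -/
instance : Valuation.RankOne (Valued.v : Valuation (kInf F) (WithZero (Multiplicative ℤ))) where
  hom' := (WithZeroMulInt.toNNReal (e := (Fintype.card F : NNReal)) (by simp)).comp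
    MonoidWithZeroHom.ValueGroup₀.embedding
  strictMono' := (WithZeroMulInt.toNNReal_strictMono
    (by exact_mod_cast Fintype.one_lt_card)).comp
    MonoidWithZeroHom.ValueGroup₀.embedding_strictMono
  exists_val_nontrivial := ⟨ratToKInf F RatFunc.X, by simp [v_ratToKInf]⟩

instance : NontriviallyNormedField (kInf F) :=
  Valued.toNontriviallyNormedField (kInf F) (WithZero (Multiplicative ℤ))

instance : IsUltrametricDist (kInf F) :=
  inferInstanceAs (@IsUltrametricDist (kInf F)
    (Valued.toNormedField (kInf F) (WithZero (Multiplicative ℤ))).toDist)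

/-- An algebraic closure of `k_∞`. -/
def kInfBar : Type u := AlgebraicClosure (kInf F)

instance : Field (kInfBar F) := inferInstanceAs (Field (AlgebraicClosure (kInf F)))

instance : Algebra (kInf F) (kInfBar F) :=
  inferInstanceAs (Algebra (kInf F) (AlgebraicClosure (kInf F)))

instance : IsAlgClosure (kInf F) (kInfBar F) :=
  inferInstanceAs (IsAlgClosure (kInf F) (AlgebraicClosure (kInf F)))

instance : Algebra.IsAlgebraic (kInf F) (kInfBar F) := IsAlgClosure.isAlgebraic

/-- The unique extension of the `∞`-adic absolute value to the algebraic closure of `k_∞`. -/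
instance : NontriviallyNormedField (kInfBar F) :=
  spectralNorm.nontriviallyNormedField (kInf F) (kInfBar F)

instance : IsUltrametricDist (kInfBar F) :=
  IsUltrametricDist.isUltrametricDist_of_forall_norm_add_le_max_norm
    (isNonarchimedean_spectralNorm (K := kInf F) (L := kInfBar F))

/-- `𝕂`, the completion of the algebraic closure of `k_∞`. -/
def CInf : Type u := UniformSpace.Completion (kInfBar F)

instance : NormedField (CInf F) :=
  inferInstanceAs (NormedField (UniformSpace.Completion (kInfBar F)))

instance : CompleteSpace (CInf F) :=
  inferInstanceAs (CompleteSpace (UniformSpace.Completion (kInfBar F)))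

/-- The inclusion of the algebraic closure of `k_∞` in `𝕂`. -/
def toCInf : kInfBar F →+* CInf F := UniformSpace.Completion.coeRingHom

theorem norm_toCInf (x : kInfBar F) : ‖toCInf F x‖ = ‖x‖ := UniformSpace.Completion.norm_coe x

theorem denseRange_toCInf : DenseRange (toCInf F) := UniformSpace.Completion.denseRange_coe

instance : IsUltrametricDist (CInf F) := by
  refine IsUltrametricDist.isUltrametricDist_of_forall_norm_add_le_max_norm fun x y => ?_
  refine (denseRange_toCInf F).induction_on₂ (p := fun x y => ‖x + y‖ ≤ max ‖x‖ ‖y‖) ?_ ?_ x y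
  · exact isClosed_le (by fun_prop) (by fun_prop)
  · intro a b
    rw [← map_add, norm_toCInf, norm_toCInf, norm_toCInf]
    exact IsUltrametricDist.norm_add_le_max a b

/-- The inclusion of `k = 𝔽_q(θ)` in `𝕂`. -/
def ratToCInf : RatFunc F →+* CInf F :=
  (toCInf F).comp ((algebraMap (kInf F) (kInfBar F)).comp (ratToKInf F))

instance : Algebra F (CInf F) := ((ratToCInf F).comp RatFunc.C).toAlgebra

theorem norm_pow_card_sub (x y : CInf F) :
    ‖x ^ Fintype.card F - y ^ Fintype.card F‖ = ‖x - y‖ ^ Fintype.card F := by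
  have h := map_sub (FiniteField.frobeniusAlgHom F (CInf F)) x y
  simp only [FiniteField.coe_frobeniusAlgHom] at h
  rw [← h, norm_pow]

theorem frobenius_surjective : Function.Surjective (fun x : CInf F => x ^ Fintype.card F) := by
  intro y
  have hq : Fintype.card F ≠ 0 := Fintype.card_ne_zero
  obtain ⟨u, hu, huy⟩ := mem_closure_iff_seq_limit.1 ((denseRange_toCInf F) y)
  choose a ha using hu
  have : IsAlgClosed (kInfBar F) := IsAlgClosure.isAlgClosed (kInf F)
  choose b hb using fun n => IsAlgClosed.exists_pow_nat_eq (a n) (Nat.pos_of_ne_zero hq)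
  have hv : ∀ n, toCInf F (b n) ^ Fintype.card F = u n := fun n => by
    rw [← map_pow, hb, ha]
  have hc : CauchySeq fun n => toCInf F (b n) := by
    rw [Metric.cauchySeq_iff]
    intro ε hε
    obtain ⟨N, hN⟩ := Metric.cauchySeq_iff.1 huy.cauchySeq (ε ^ Fintype.card F) (pow_pos hε _)
    refine ⟨N, fun m hm n hn => ?_⟩
    have := hN m hm n hn
    rw [dist_eq_norm, ← hv, ← hv, norm_pow_card_sub] at this
    rw [dist_eq_norm]
    exact lt_of_pow_lt_pow_left₀ _ hε.le this
  obtain ⟨x, hx⟩ := cauchySeq_tendsto_of_complete hc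
  refine ⟨x, tendsto_nhds_unique ((hx.pow _).congr fun n => ?_) huy⟩
  exact hv n

/-- The automorphism `a ↦ a^(1/q)` of `𝕂`. -/
def sigmaCInf : CInf F ≃+* CInf F :=
  (RingEquiv.ofBijective (FiniteField.frobeniusAlgHom F (CInf F))
    ⟨RingHom.injective _, frobenius_surjective F⟩).symm

theorem sigmaCInf_pow (x : CInf F) : sigmaCInf F x ^ Fintype.card F = x :=
  (RingEquiv.ofBijective (FiniteField.frobeniusAlgHom F (CInf F))
    ⟨RingHom.injective _, frobenius_surjective F⟩).apply_symm_apply x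

theorem sigmaCInf_symm_apply (x : CInf F) : (sigmaCInf F).symm x = x ^ Fintype.card F := rfl

/-! ### The fields `k̄` and `k̄(t)` -/

/-- `k̄`, the algebraic closure of `k` in `𝕂`. -/
def kBar : Subfield (CInf F) :=
  (algebraicClosure (ratToCInf F).fieldRange (CInf F)).toSubfield

theorem mem_kBar {x : CInf F} : x ∈ kBar F ↔ IsAlgebraic (ratToCInf F).fieldRange x :=
  mem_algebraicClosure_iff

theorem sigmaCInf_mem {x : CInf F} : sigmaCInf F x ∈ kBar F ↔ x ∈ kBar F := by
  constructor
  · intro h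
    rw [← sigmaCInf_pow F x]
    exact pow_mem h _
  · intro h
    rw [mem_kBar] at h ⊢
    refine IsAlgebraic.of_pow (n := Fintype.card F) Fintype.card_pos ?_
    rwa [sigmaCInf_pow]

/-- The inclusion of `𝔽_q` in `k̄`. -/
def constToKBar : F →+* kBar F :=
  ((ratToCInf F).comp RatFunc.C).codRestrict (kBar F) fun c => (mem_kBar F).2 <|
    isAlgebraic_algebraMap (⟨ratToCInf F (RatFunc.C c), ⟨_, rfl⟩⟩ : (ratToCInf F).fieldRange)

/-- The automorphism `a ↦ a^(1/q)` of `k̄`. -/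
def sigmaKBar : kBar F ≃+* kBar F :=
  RingEquiv.ofRingHom
    (((sigmaCInf F : CInf F →+* CInf F).comp (kBar F).subtype).codRestrict (kBar F)
      fun x => (sigmaCInf_mem F).2 x.2)
    ((((sigmaCInf F).symm : CInf F →+* CInf F).comp (kBar F).subtype).codRestrict (kBar F)
      fun x => pow_mem x.2 _)
    (by ext x; exact (sigmaCInf F).apply_symm_apply _)
    (by ext x; exact (sigmaCInf F).symm_apply_apply _)

theorem coe_sigmaKBar (x : kBar F) : (sigmaKBar F x : CInf F) = sigmaCInf F x := rfl

theorem sigmaKBar_const (c : F) : sigmaKBar F (constToKBar F c) = constToKBar F c := by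
  apply Subtype.ext
  rw [coe_sigmaKBar, ← (sigmaCInf F).symm.injective.eq_iff, RingEquiv.symm_apply_apply,
    sigmaCInf_symm_apply]
  change algebraMap F (CInf F) c = algebraMap F (CInf F) c ^ _
  rw [← map_pow, FiniteField.pow_card]

/-- `k̄(t)`, rational functions in `t` over `k̄`. -/
def kBarT : Type u := RatFunc (kBar F)

instance : Field (kBarT F) := inferInstanceAs (Field (RatFunc (kBar F)))

instance : Algebra (kBar F)[X] (kBarT F) :=
  inferInstanceAs (Algebra (kBar F)[X] (RatFunc (kBar F)))

instance : IsFractionRing (kBar F)[X] (kBarT F) :=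
  inferInstanceAs (IsFractionRing (kBar F)[X] (RatFunc (kBar F)))

/-- The automorphism `σ` of `k̄(t)`: it takes `q`-th roots of the coefficients and fixes `t`. -/
def sigmaT : kBarT F ≃+* kBarT F :=
  IsFractionRing.ringEquivOfRingEquiv (mapEquiv (sigmaKBar F))

/-- The inclusion `𝔽_q(t) → k̄(t)`, which sends `t` to `t`. -/
instance : Algebra (RatFunc F) (kBarT F) :=
  (IsFractionRing.lift (A := F[X]) (K := RatFunc F)
    (g := (algebraMap (kBar F)[X] (kBarT F)).comp (mapRingHom (constToKBar F)))
    ((IsFractionRing.injective _ _).comp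
      (map_injective _ (constToKBar F).injective))).toAlgebra

theorem algebraMap_ratFunc_kBarT (f : F[X]) :
    algebraMap (RatFunc F) (kBarT F) (algebraMap F[X] (RatFunc F) f) =
      algebraMap (kBar F)[X] (kBarT F) (f.map (constToKBar F)) :=
  IsFractionRing.lift_algebraMap _ _

theorem sigmaT_algebraMap (f : (kBar F)[X]) :
    sigmaT F (algebraMap (kBar F)[X] (kBarT F) f) =
      algebraMap (kBar F)[X] (kBarT F) (f.map (sigmaKBar F : kBar F →+* kBar F)) :=
  IsFractionRing.ringEquivOfRingEquiv_algebraMap _ _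

theorem sigmaT_const (c : RatFunc F) :
    sigmaT F (algebraMap (RatFunc F) (kBarT F) c) = algebraMap (RatFunc F) (kBarT F) c := by
  have h : (sigmaT F : kBarT F →+* kBarT F).comp (algebraMap (RatFunc F) (kBarT F)) =
      algebraMap (RatFunc F) (kBarT F) := by
    refine IsLocalization.ringHom_ext (nonZeroDivisors F[X]) (RingHom.ext fun f => ?_)
    simp only [RingHom.comp_apply, RingEquiv.coe_toRingHom, algebraMap_ratFunc_kBarT,
      sigmaT_algebraMap, Polynomial.map_map]
    congr 2
    exact RingHom.ext (sigmaKBar_const F)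
  exact RingHom.congr_fun h c

/-! ### The Tate algebra `𝕋` and its fraction field `𝕃` -/

/-- `𝕋`, the power series in `t` over `𝕂` whose coefficients tend to `0`. -/
abbrev Tate : Subring (PowerSeries (CInf F)) := PowerSeries.IsRestricted.subring 1

theorem mem_Tate {f : PowerSeries (CInf F)} :
    f ∈ Tate F ↔ Filter.Tendsto (fun n => ‖PowerSeries.coeff n f‖) Filter.atTop (nhds 0) := by
  have := PowerSeries.isRestricted_iff' (R := CInf F) 1 f
  simp only [one_pow, mul_one] at this
  exact this

/-- The inclusion `k̄[t] → 𝕋`. -/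
def polyToTate : (kBar F)[X] →+* Tate F :=
  ((coeToPowerSeries.ringHom (R := CInf F)).comp (mapRingHom (kBar F).subtype)).codRestrict (Tate F)
   fun f => by
    rw [mem_Tate]
    refine tendsto_const_nhds.congr' ?_
    filter_upwards [Filter.eventually_gt_atTop f.natDegree] with n hn
    simp [coeff_eq_zero_of_natDegree_lt hn]

theorem polyToTate_injective : Function.Injective (polyToTate F) := by
  intro f g h
  have := congrArg Subtype.val h
  exact map_injective _ (kBar F).subtype.injective (coe_injective _ this)

theorem map_sigma_mem (f : PowerSeries (CInf F)) :
    f.map (sigmaCInf F : CInf F →+* CInf F) ∈ Tate F ↔ f ∈ Tate F := by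
  have hq : Fintype.card F ≠ 0 := Fintype.card_ne_zero
  have key : ∀ n, ‖PowerSeries.coeff n f‖ =
      ‖PowerSeries.coeff n (f.map (sigmaCInf F : CInf F →+* CInf F))‖ ^ Fintype.card F := by
    intro n
    rw [← norm_pow, PowerSeries.coeff_map, RingEquiv.coe_toRingHom, sigmaCInf_pow]
  rw [mem_Tate, mem_Tate]
  simp only [key]
  constructor
  · intro h
    simpa [hq] using h.pow (Fintype.card F)
  · intro h
    rw [Metric.tendsto_atTop] at h ⊢
    intro ε hε
    obtain ⟨N, hN⟩ := h (ε ^ Fintype.card F) (pow_pos hε _)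
    refine ⟨N, fun n hn => ?_⟩
    have := hN n hn
    rw [dist_zero_right, norm_pow, norm_norm] at this
    rw [dist_zero_right, norm_norm]
    exact lt_of_pow_lt_pow_left₀ _ hε.le this

/-- The automorphism `∑ aᵢ tⁱ ↦ ∑ aᵢ^(1/q) tⁱ` of `𝕋`. -/
def sigmaTate : Tate F ≃+* Tate F :=
  RingEquiv.ofRingHom
    (((PowerSeries.map (sigmaCInf F : CInf F →+* CInf F)).comp (Tate F).subtype).codRestrict
      (Tate F) fun x => (map_sigma_mem F _).2 x.2)
    (((PowerSeries.map ((sigmaCInf F).symm : CInf F →+* CInf F)).comp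
      (Tate F).subtype).codRestrict (Tate F) fun x => by
        rw [← map_sigma_mem]
        convert x.2
        ext n
        simp)
    (by ext x; simp) (by ext x; simp)

/-- `𝕃`, the fraction field of `𝕋`. -/
def LL : Type u := FractionRing (Tate F)

instance : Field (LL F) := inferInstanceAs (Field (FractionRing (Tate F)))

instance : Algebra (Tate F) (LL F) := inferInstanceAs (Algebra (Tate F) (FractionRing (Tate F)))

instance : IsFractionRing (Tate F) (LL F) :=
  inferInstanceAs (IsFractionRing (Tate F) (FractionRing (Tate F)))

/-- The automorphism `σ` of `𝕃`. -/
def sigmaL : LL F ≃+* LL F := IsFractionRing.ringEquivOfRingEquiv (sigmaTate F)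

/-- The inclusion `k̄(t) → 𝕃`. -/
instance : Algebra (kBarT F) (LL F) :=
  (IsFractionRing.lift (A := (kBar F)[X]) (K := kBarT F)
    (g := (algebraMap (Tate F) (LL F)).comp (polyToTate F))
    ((IsFractionRing.injective _ _).comp (polyToTate_injective F))).toAlgebra

theorem algebraMap_poly_LL (f : (kBar F)[X]) :
    algebraMap (kBarT F) (LL F) (algebraMap (kBar F)[X] (kBarT F) f) =
      algebraMap (Tate F) (LL F) (polyToTate F f) :=
  IsFractionRing.lift_algebraMap _ _

theorem sigmaL_algebraMap (r : kBarT F) :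
    sigmaL F (algebraMap (kBarT F) (LL F) r) = algebraMap (kBarT F) (LL F) (sigmaT F r) := by
  have h : (sigmaL F : LL F →+* LL F).comp (algebraMap (kBarT F) (LL F)) =
      (algebraMap (kBarT F) (LL F)).comp (sigmaT F : kBarT F →+* kBarT F) := by
    refine IsLocalization.ringHom_ext (nonZeroDivisors (kBar F)[X]) (RingHom.ext fun f => ?_)
    simp only [RingHom.comp_apply, RingEquiv.coe_toRingHom, algebraMap_poly_LL,
      sigmaT_algebraMap]
    refine (IsFractionRing.ringEquivOfRingEquiv_algebraMap (sigmaTate F) _).trans ?_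
    refine congrArg _ (Subtype.ext (PowerSeries.ext fun n => ?_))
    change sigmaCInf F (PowerSeries.coeff n (f.map (kBar F).subtype : (CInf F)[X])) =
      PowerSeries.coeff n
        ((f.map (sigmaKBar F : kBar F →+* kBar F)).map (kBar F).subtype : (CInf F)[X])
    simp [coe_sigmaKBar]
  exact RingHom.congr_fun h r

/-- The inclusion `𝔽_q(t) → k̄(t) → 𝕃`. -/
instance : Algebra (RatFunc F) (LL F) :=
  ((algebraMap (kBarT F) (LL F)).comp (algebraMap (RatFunc F) (kBarT F))).toAlgebra

instance : IsScalarTower (RatFunc F) (kBarT F) (LL F) := IsScalarTower.of_algebraMap_eq fun _ => rfl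

end Constants

attribute [local instance] RingHomInvPair.of_ringEquiv RingHomInvPair.of_ringEquiv_symm

/-! ### Difference modules over a field with an automorphism -/

/-- A left module over the skew Laurent polynomial ring `R[σ, σ⁻¹]` (where `σ f = s(f) σ`) which is
finite dimensional over `R`: a finite-dimensional `R`-vector space with an additive bijection `σ`
such that `σ (f m) = s(f) σ(m)`. -/
structure DiffModule (R : Type u) [Field R] (s : R ≃+* R) where
  /-- The underlying type. -/
  carrier : Type u
  [addCommGroup : AddCommGroup carrier]
  [module : Module R carrier]
  [finite : Module.Finite R carrier]
  /-- Multiplication by `σ`. -/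
  sigma : carrier ≃ₛₗ[(s : R →+* R)] carrier

namespace DiffModule

variable {R : Type u} [Field R] {s : R ≃+* R}

instance : CoeSort (DiffModule R s) (Type u) := ⟨carrier⟩

attribute [instance] addCommGroup module finite

/-- The group of homomorphisms of left `R[σ, σ⁻¹]`-modules: `R`-linear maps commuting with `σ`. -/
def homs (P Q : DiffModule R s) : AddSubgroup (P →ₗ[R] Q) where
  carrier := {f | ∀ x, f (P.sigma x) = Q.sigma (f x)}
  zero_mem' x := by simp
  add_mem' hf hg x := by simp [hf x, hg x]
  neg_mem' hf x := by simp [hf x]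

instance : Category (DiffModule R s) where
  Hom P Q := homs P Q
  id P := ⟨LinearMap.id, fun _ => rfl⟩
  comp f g := ⟨g.1.comp f.1, fun x => by simp [f.2 x, g.2 (f.1 x)]⟩

instance : Preadditive (DiffModule R s) where
  homGroup P Q := inferInstanceAs (AddCommGroup (homs P Q))
  add_comp _ _ _ f f' g := Subtype.ext (LinearMap.comp_add f.1 f'.1 g.1)
  comp_add _ _ _ f g g' := Subtype.ext (LinearMap.add_comp f.1 g'.1 g.1)

/-- An `R`-linear bijection commuting with `σ` is an isomorphism. -/
def mkIso {P Q : DiffModule R s} (e : P ≃ₗ[R] Q) (h : ∀ x, e (P.sigma x) = Q.sigma (e x)) :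
    P ≅ Q where
  hom := ⟨e, h⟩
  inv := ⟨e.symm, fun x => by
    simp only [LinearEquiv.coe_coe, LinearEquiv.symm_apply_eq, h, e.apply_symm_apply]⟩
  hom_inv_id := Subtype.ext e.symm_comp
  inv_hom_id := Subtype.ext e.comp_symm

variable (R s) in
/-- The functor forgetting `σ`. -/
def forgetful : DiffModule R s ⥤ ModuleCat.{u} R where
  obj P := ModuleCat.of R P
  map f := ModuleCat.ofHom f.1

instance : (forgetful R s).Faithful where
  map_injective h := Subtype.ext (congrArg ModuleCat.Hom.hom h)

instance : (forgetful R s).Additive where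

/-- `P ⊗ Q` over `R`, with `σ (m ⊗ n) = σ m ⊗ σ n`. -/
def tensor (P Q : DiffModule R s) : DiffModule R s where
  carrier := P ⊗[R] Q
  sigma := TensorProduct.congr P.sigma Q.sigma

/-- `s` as an `s`-semilinear bijection of `R`. -/
def unitSigma (s : R ≃+* R) : R ≃ₛₗ[(s : R →+* R)] R :=
  { s with map_smul' := fun a b => by simp }

variable (R s) in
/-- The identity object: `R` itself, with `σ f = s(f)`. -/
def unit : DiffModule R s where
  carrier := R
  sigma := unitSigma s

theorem eq_of_tmul {M N W : Type u} [AddCommGroup M] [Module R M] [AddCommGroup N] [Module R N]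
    [AddCommGroup W] [Module R W] (a b : M ⊗[R] N →ₛₗ[(s : R →+* R)] W)
    (h : ∀ m n, a (m ⊗ₜ n) = b (m ⊗ₜ n)) (x : M ⊗[R] N) : a x = b x :=
  LinearMap.congr_fun (TensorProduct.ext' h) x

/-- The tensor product of two homomorphisms. -/
def tensorHom {P P' Q Q' : DiffModule R s} (f : P ⟶ P') (g : Q ⟶ Q') :
    tensor P Q ⟶ tensor P' Q' :=
  ⟨TensorProduct.map f.1 g.1, eq_of_tmul
    ((TensorProduct.map f.1 g.1).comp (TensorProduct.map P.sigma.toLinearMap Q.sigma.toLinearMap))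
    ((TensorProduct.map P'.sigma.toLinearMap Q'.sigma.toLinearMap).comp (TensorProduct.map f.1 g.1))
    fun x y => congrArg₂ (· ⊗ₜ[R] ·) (f.2 x) (g.2 y)⟩

theorem assoc_sigma (P Q T : DiffModule R s) (x : (P ⊗[R] Q) ⊗[R] T) :
    TensorProduct.assoc R P Q T
        (TensorProduct.congr (TensorProduct.congr P.sigma Q.sigma) T.sigma x) =
      TensorProduct.congr P.sigma (TensorProduct.congr Q.sigma T.sigma)
        (TensorProduct.assoc R P Q T x) := by
  induction x using TensorProduct.induction_on with
  | zero => simp only [map_zero]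
  | add x y hx hy => rw [map_add, map_add, hx, hy, map_add, map_add]
  | tmul x z =>
    induction x using TensorProduct.induction_on with
    | zero => simp only [zero_tmul, map_zero]
    | add x y hx hy => rw [add_tmul, map_add, map_add, hx, hy, map_add, map_add]
    | tmul x y => rfl

theorem comm_sigma (P Q : DiffModule R s) (x : P ⊗[R] Q) :
    TensorProduct.comm R P Q (TensorProduct.congr P.sigma Q.sigma x) =
      TensorProduct.congr Q.sigma P.sigma (TensorProduct.comm R P Q x) := by
  induction x using TensorProduct.induction_on with
  | zero => simp only [map_zero]
  | add x y hx hy => rw [map_add, map_add, hx, hy, map_add, map_add]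
  | tmul x z => rfl

theorem lid_sigma (P : DiffModule R s) (x : R ⊗[R] P) :
    TensorProduct.lid R P (TensorProduct.congr (unitSigma s) P.sigma x) =
      P.sigma (TensorProduct.lid R P x) := by
  induction x using TensorProduct.induction_on with
  | zero => simp only [map_zero]
  | add x y hx hy => rw [map_add, map_add, hx, hy, map_add, map_add]
  | tmul x y => exact (map_smulₛₗ P.sigma x y).symm

theorem rid_sigma (P : DiffModule R s) (x : P ⊗[R] R) :
    TensorProduct.rid R P (TensorProduct.congr P.sigma (unitSigma s) x) =
      P.sigma (TensorProduct.rid R P x) := by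
  induction x using TensorProduct.induction_on with
  | zero => simp only [map_zero]
  | add x y hx hy => rw [map_add, map_add, hx, hy, map_add, map_add]
  | tmul x y => exact (map_smulₛₗ P.sigma y x).symm

/-- The tensor structure, with the usual associativity and unit isomorphisms of vector spaces. -/
instance : MonoidalCategoryStruct (DiffModule R s) where
  tensorObj := tensor
  tensorUnit := unit R s
  tensorHom := tensorHom
  whiskerLeft P _ _ f := tensorHom (𝟙 P) f
  whiskerRight f P := tensorHom f (𝟙 P)
  associator P Q T := mkIso (TensorProduct.assoc R P Q T) (assoc_sigma P Q T)
  leftUnitor P := mkIso (TensorProduct.lid R P) (lid_sigma P)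
  rightUnitor P := mkIso (TensorProduct.rid R P) (rid_sigma P)

variable (R s) in
/-- The forgetful functor respects all the data of the tensor structure. -/
def inducing : Monoidal.InducingFunctorData (forgetful R s) where
  μIso _ _ := Iso.refl _
  εIso := Iso.refl _
  whiskerLeft_eq _ _ _ _ := rfl
  whiskerRight_eq _ _ := rfl
  tensorHom_eq _ _ := rfl
  associator_eq P Q T := by
    apply ModuleCat.hom_ext
    apply TensorProduct.ext_threefold
    intro x y z
    rfl
  leftUnitor_eq P := by
    apply ModuleCat.hom_ext
    apply TensorProduct.ext'
    intro x y
    rfl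
  rightUnitor_eq P := by
    apply ModuleCat.hom_ext
    apply TensorProduct.ext'
    intro x y
    rfl

instance : MonoidalCategory (DiffModule R s) :=
  Monoidal.induced (forgetful R s) (inducing R s)

instance : (forgetful R s).Monoidal := Monoidal.fromInducedMonoidal (forgetful R s) (inducing R s)

/-- The commutativity isomorphism is `m ⊗ n ↦ n ⊗ m`. -/
instance : BraidedCategory (DiffModule R s) :=
  .ofFaithful (forgetful R s) (fun P Q => mkIso (TensorProduct.comm R P Q) (comm_sigma P Q))
    fun P Q => by
      apply ModuleCat.hom_ext
      apply TensorProduct.ext'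
      intro x y
      rfl

instance : (forgetful R s).Braided where
  braided P Q := by
    apply ModuleCat.hom_ext
    apply TensorProduct.ext'
    intro x y
    rfl

instance : SymmetricCategory (DiffModule R s) := .ofFaithful (forgetful R s)

end DiffModule

/-! ### Pre-`t`-motives -/

/-- The category `𝒫` of pre-`t`-motives: left `k̄(t)[σ, σ⁻¹]`-modules that are finite dimensional
over `k̄(t)`. -/
abbrev PreTMotive (F : Type u) [Field F] [Fintype F] := DiffModule (kBarT F) (sigmaT F)

namespace PreTMotive

variable {F : Type u} [Field F] [Fintype F]

/-- An element of `𝔽_q(t)` acts on a morphism through `𝔽_q(t) ⊆ k̄(t)`. -/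
instance (P Q : PreTMotive F) : SMul (RatFunc F) (P ⟶ Q) where
  smul c f := ⟨algebraMap (RatFunc F) (kBarT F) c • f.1, fun x => by
    have h : Q.sigma (algebraMap (RatFunc F) (kBarT F) c • f.1 x) =
        sigmaT F (algebraMap (RatFunc F) (kBarT F) c) • Q.sigma (f.1 x) := map_smulₛₗ Q.sigma _ _
    rw [LinearMap.smul_apply, LinearMap.smul_apply, h, sigmaT_const, f.2 x]⟩

theorem smul_val {P Q : PreTMotive F} (c : RatFunc F) (f : P ⟶ Q) :
    (c • f).1 = algebraMap (RatFunc F) (kBarT F) c • f.1 := rfl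

instance (P Q : PreTMotive F) : Module (RatFunc F) (P ⟶ Q) where
  one_smul f := Subtype.ext (by rw [smul_val, map_one, one_smul])
  mul_smul a b f := Subtype.ext (by simp only [smul_val, map_mul, mul_smul])
  smul_zero a := Subtype.ext (smul_zero (algebraMap (RatFunc F) (kBarT F) a))
  smul_add a f g := Subtype.ext (smul_add (algebraMap (RatFunc F) (kBarT F) a) f.1 g.1)
  add_smul a b f := Subtype.ext (by rw [smul_val, map_add, add_smul]; rfl)
  zero_smul f := Subtype.ext (by rw [smul_val, map_zero, zero_smul]; rfl)

instance : Linear (RatFunc F) (PreTMotive F) where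
  smul_comp _ _ _ a f g :=
    Subtype.ext (LinearMap.comp_smul g.1 (algebraMap (RatFunc F) (kBarT F) a) f.1)
  comp_smul _ _ _ f a g :=
    Subtype.ext (LinearMap.smul_comp (algebraMap (RatFunc F) (kBarT F) a) g.1 f.1)

variable (F) in
/-- `σ : 𝕃 → 𝕃` as a semilinear map over `σ : k̄(t) → k̄(t)`. -/
def sigmaLSemi : LL F →ₛₗ[(sigmaT F : kBarT F →+* kBarT F)] LL F :=
  { sigmaL F with
    map_smul' := fun r x => by
      simp [Algebra.smul_def, sigmaL_algebraMap] }

/-- `P† = 𝕃 ⊗ P`, the tensor product being over `k̄(t)`. -/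
abbrev Dagger (P : PreTMotive F) : Type u := LL F ⊗[kBarT F] P

/-- The action of `σ` on `P†`, given by `σ (f ⊗ m) = σ(f) ⊗ σ m`. -/
def daggerSigma (P : PreTMotive F) :
    P.Dagger →ₛₗ[(sigmaT F : kBarT F →+* kBarT F)] P.Dagger :=
  TensorProduct.map (sigmaLSemi F) P.sigma.toLinearMap

theorem daggerSigma_tmul (P : PreTMotive F) (f : LL F) (m : P) :
    P.daggerSigma (f ⊗ₜ m) = sigmaL F f ⊗ₜ P.sigma m := rfl

/-- `P^B`, the `𝔽_q(t)`-vector space of `σ`-invariants in `P†`. -/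
def betti (P : PreTMotive F) : Submodule (RatFunc F) P.Dagger where
  carrier := {μ | P.daggerSigma μ = μ}
  zero_mem' := map_zero _
  add_mem' {x y} (hx : _ = _) (hy : _ = _) := show P.daggerSigma (x + y) = x + y by
    rw [map_add, hx, hy]
  smul_mem' c x (hx : _ = _) := show P.daggerSigma (c • x) = c • x by
    rw [← algebraMap_smul (kBarT F) c x, map_smulₛₗ, hx, RingEquiv.coe_toRingHom, sigmaT_const]

theorem daggerSigma_baseChange {P Q : PreTMotive F} (f : P ⟶ Q) (x : P.Dagger) :
    Q.daggerSigma (f.1.baseChange (LL F) x) = f.1.baseChange (LL F) (P.daggerSigma x) := by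
  induction x using TensorProduct.induction_on with
  | zero => simp only [map_zero]
  | add x y hx hy => simp only [map_add, hx, hy]
  | tmul g m => exact congrArg (sigmaL F g ⊗ₜ[kBarT F] ·) (f.2 m).symm

/-- The map `P^B → Q^B` induced by a morphism `P → Q`. -/
def bettiMap {P Q : PreTMotive F} (f : P ⟶ Q) : P.betti →ₗ[RatFunc F] Q.betti :=
  ((f.1.baseChange (LL F)).restrictScalars (RatFunc F)).restrict
    fun x (hx : P.daggerSigma x = x) => (daggerSigma_baseChange f x).trans (congrArg _ hx)

/-- The natural map from `𝕃 ⊗ P^B` (over `𝔽_q(t)`) to `P†`, sending `f ⊗ μ` to `f μ`. -/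
def bettiComparison (P : PreTMotive F) : LL F ⊗[RatFunc F] P.betti →ₗ[LL F] P.Dagger :=
  LinearMap.liftBaseChange (LL F) P.betti.subtype

variable (F) in
/-- `P` is rigid analytically trivial if the natural map `𝕃 ⊗ P^B → P†` is an isomorphism. -/
def isRAT : ObjectProperty (PreTMotive F) := fun P => Function.Bijective P.bettiComparison

theorem finite_betti {P : PreTMotive F} (hP : isRAT F P) : Module.Finite (RatFunc F) P.betti := by
  have : Module.Free (RatFunc F) P.betti := Module.Free.of_divisionRing (RatFunc F) P.betti
  have h : Module.rank (LL F) (LL F ⊗[RatFunc F] P.betti) = Module.rank (LL F) P.Dagger :=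
    (LinearEquiv.ofBijective _ hP).rank_eq
  rw [Module.rank_baseChange, Cardinal.lift_id] at h
  rw [← Module.rank_lt_aleph0_iff, h]
  exact Module.rank_lt_aleph0 _ _

/-- The natural pairing `P† × Q† → (P ⊗ Q)†`, `(f ⊗ m, g ⊗ n) ↦ fg ⊗ (m ⊗ n)`. -/
def daggerTensor {P Q : PreTMotive F} (x : P.Dagger) (y : Q.Dagger) :
    (P ⊗ Q : PreTMotive F).Dagger :=
  (TensorProduct.AlgebraTensorModule.distribBaseChange (kBarT F) (LL F) P Q).symm (x ⊗ₜ[LL F] y)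

end PreTMotive

open PreTMotive

/-- The category `ℛ`: the full subcategory of rigid analytically trivial pre-`t`-motives. -/
abbrev RATMotive (F : Type u) [Field F] [Fintype F] := (isRAT F).FullSubcategory

/-- The functor `P ↦ P^B` from `ℛ` to finite-dimensional `𝔽_q(t)`-vector spaces. -/
def bettiFunctor (F : Type u) [Field F] [Fintype F] : RATMotive F ⥤ FGModuleCat.{u} (RatFunc F) where
  obj P :=
    have := finite_betti P.property
    FGModuleCat.of (RatFunc F) P.obj.betti
  map {P Q} f :=
    have := finite_betti P.property
    have := finite_betti Q.property
    FGModuleCat.ofHom (bettiMap f.hom)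
  map_id P := by
    apply ObjectProperty.hom_ext
    apply ModuleCat.hom_ext
    apply LinearMap.ext
    intro x
    apply Subtype.ext
    exact LinearMap.congr_fun (LinearMap.baseChange_id (R := kBarT F) (A := LL F)) x.1
  map_comp {P Q T} f g := by
    apply ObjectProperty.hom_ext
    apply ModuleCat.hom_ext
    apply LinearMap.ext
    intro x
    apply Subtype.ext
    exact LinearMap.congr_fun (LinearMap.baseChange_comp (A := LL F) (f := f.hom.1) g.hom.1) x.1

/-! ### Neutral Tannakian categories -/

/-- A `k`-linear category with a symmetric tensor product is a rigid abelian `k`-linear tensor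
category with `k = End(𝟙)`: it is abelian, the tensor product is `k`-bilinear on morphisms, every
object has a dual, and the scalars are exactly the endomorphisms of the identity object. -/
structure IsRigidAbelianTensor (k : Type*) [Field k] (C : Type*) [Category C] [hC : Preadditive C]
    [Linear k C] [MonoidalCategory C] [SymmetricCategory C] : Prop where
  abelian : ∃ A : Abelian C, A.toPreadditive = hC
  tensor_additive : MonoidalPreadditive C
  tensor_linear : MonoidalLinear k C
  rigid : Nonempty (RigidCategory C)
  end_unit : Function.Bijective fun c : k => c • 𝟙 (𝟙_ C)

/-- A tensor functor (a strong monoidal functor compatible with the commutativity isomorphisms) to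
finite-dimensional `k`-vector spaces is a fiber functor if it is `k`-linear, exact and faithful. -/
structure IsFiberFunctor (k : Type u) [Field k] {C : Type*} [Category C] [Preadditive C]
    [Linear k C] [MonoidalCategory C] [SymmetricCategory C] (ω : C ⥤ FGModuleCat.{u} k)
    [ω.Braided] : Prop where
  additive : ω.Additive
  linear : ω.Linear k
  faithful : ω.Faithful
  left_exact : Limits.PreservesFiniteLimits ω
  right_exact : Limits.PreservesFiniteColimits ω

end TMotive

end

/-!
# Rigid analytically trivial pre-`t`-motives form a neutral Tannakian category

The field of `σ`-invariants in `𝕃` is `𝔽_q(t)` (`exists_algebraMap_eq_of_sigmaL_eq`).  Indeed, if a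
quotient `a / b` of elements of `𝕋` is invariant, then for some `n` the power series `c = tⁿ a / b`
exists and has coefficients in `𝔽_q`.  An `𝔽_q`-linear functional on `𝕂` that vanishes on the open
unit ball turns the two sides of `b c = tⁿ a` into polynomials over `𝔽_q`, times `c` on the left,
because the coefficients of `a` and `b` tend to `0`.  So `c` is a quotient of polynomials, provided
that the functional does not kill every coefficient of `b`, which scaling `a` and `b` achieves.

By Artin's argument, `𝔽_q(t)`-linearly independent invariants of `P†` are then `𝕃`-linearly
independent (`linearIndependent_of_fixed`).  Hence the comparison map `𝕃 ⊗ P^B → P†` is injective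
for every `P`, and `P` is rigid analytically trivial as soon as it is surjective
(`PreTMotive.isRAT_of_surjective`).  Everything else follows from this and the faithful flatness of
field extensions.

* For subobjects, quotients and direct sums the comparison map is surjective by a diagram chase, and
  pre-`t`-motives form an abelian category, with kernels and cokernels those of vector spaces.
  Hence `ℛ` is abelian.
* After base change to `𝕃` the functor `P ↦ P^B` becomes `P ↦ P†` on `ℛ`, so it is exact and
  faithful there (`PreTMotive.bettiMap_exact`, `PreTMotive.bettiMap_injective`).
* The image of `P^B ⊗ Q^B` in `(P ⊗ Q)†` spans it over `𝕃`, so `P ⊗ Q` lies in `ℛ`; comparing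
  dimensions, `P^B ⊗ Q^B → (P ⊗ Q)^B` is an isomorphism (`PreTMotive.bettiTensor_bijective`).
* A basis of `P^B` is an `𝕃`-basis of `P†`, and the dual basis consists of invariants of the dual
  of `P`, which therefore lies in `ℛ` (`PreTMotive.isRAT_dual`).
-/

noncomputable section

namespace TMotive

/-! ### The fixed field of `σ` on `𝕃` -/

section FixedField

variable (F : Type u) [Field F] [Fintype F]

theorem exists_algebraMap_eq_of_sigmaCInf_eq {x : CInf F} (h : sigmaCInf F x = x) :
    ∃ c : F, algebraMap F (CInf F) c = x := by
  have hx : x ^ Fintype.card F = x := by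
    conv_lhs => rw [← h]
    exact sigmaCInf_pow F x
  have hroots : (X ^ Fintype.card F - X : F[X]).roots.card =
      (X ^ Fintype.card F - X : F[X]).natDegree := by
    rw [FiniteField.roots_X_pow_card_sub_X,
      FiniteField.X_pow_card_sub_X_natDegree_eq F Fintype.one_lt_card]
    simp
  have hne : (X ^ Fintype.card F - X : F[X]) ≠ 0 :=
    FiniteField.X_pow_card_sub_X_ne_zero F Fintype.one_lt_card
  have hsplit := Polynomial.splits_iff_card_roots.2 hroots
  have hmem := hsplit.mem_range_of_isRoot hne (x := x) (i := algebraMap F (CInf F)) (by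
    simp [hx])
  simpa using hmem

theorem norm_algebraMap_le_one (c : F) : ‖algebraMap F (CInf F) c‖ ≤ 1 := by
  by_cases hc : c = 0
  · simp [hc]
  · have hq : Fintype.card F - 1 ≠ 0 := by
      have := Fintype.one_lt_card (α := F)
      omega
    refine ((pow_eq_one_iff_of_nonneg (norm_nonneg _) hq).1 ?_).le
    rw [← norm_pow, ← map_pow, FiniteField.pow_card_sub_one_eq_one c hc, map_one, norm_one]

/-- A nonzero `F`-linear functional on `𝕂` vanishing on the open unit ball.  Applied to the
coefficients, it turns elements of `𝕋` into polynomials over `F`. -/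
theorem exists_functional :
    ∃ ψ : CInf F →ₗ[F] F, (∀ x, ‖x‖ < 1 → ψ x = 0) ∧ ψ 1 ≠ 0 := by
  let p : Submodule F (CInf F) :=
    { carrier := {x | ‖x‖ < 1}
      zero_mem' := by simp
      add_mem' := fun {x y} hx hy =>
        (IsUltrametricDist.norm_add_le_max x y).trans_lt (max_lt hx hy)
      smul_mem' := fun c x (hx : ‖x‖ < 1) => by
        change ‖c • x‖ < 1
        rw [Algebra.smul_def, norm_mul]
        exact (mul_le_of_le_one_left (norm_nonneg _) (norm_algebraMap_le_one F c)).trans_lt hx }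
  have h1 : (1 : CInf F) ∉ p := fun h : ‖(1 : CInf F)‖ < 1 => by simp at h
  obtain ⟨ψ, h, hp⟩ := Submodule.exists_le_ker_of_notMem h1
  exact ⟨ψ, fun x hx => hp hx, h⟩

variable {F}

/-- A power series with coefficients in `F` that is a quotient of two elements of `𝕋` is a quotient
of two polynomials over `F`. -/
theorem exists_polynomial_mul_eq {a b : PowerSeries (CInf F)} (ha : a ∈ Tate F) (hb : b ∈ Tate F)
    (hb0 : b ≠ 0) {c : PowerSeries F} (h : b * c.map (algebraMap F (CInf F)) = a) :
    ∃ p r : F[X], r ≠ 0 ∧ (r : PowerSeries F) * c = p := by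
  obtain ⟨ψ, hψ, hψ1⟩ := exists_functional F
  obtain ⟨j, hj⟩ : ∃ j, PowerSeries.coeff j b ≠ 0 := by
    by_contra! hcon
    exact hb0 (PowerSeries.ext hcon)
  -- After scaling, some coefficient of `b` is `1`, so that `ψ` does not kill `b`.
  set u := (PowerSeries.coeff j b)⁻¹
  have key : ∀ f ∈ Tate F, ∃ p : F[X], ∀ n, p.coeff n = ψ (u * PowerSeries.coeff n f) := by
    intro f hf
    rw [mem_Tate] at hf
    have h0 : Filter.Tendsto (fun n => ‖u * PowerSeries.coeff n f‖) Filter.atTop (nhds 0) := by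
      simpa using hf.const_mul ‖u‖
    obtain ⟨N, hN⟩ := Filter.eventually_atTop.1 (h0.eventually_lt_const zero_lt_one)
    refine ⟨PowerSeries.trunc N (.mk fun n => ψ (u * PowerSeries.coeff n f)), fun n => ?_⟩
    rw [PowerSeries.coeff_trunc, PowerSeries.coeff_mk]
    split_ifs with hn
    · rfl
    · exact (hψ _ (hN n (not_lt.1 hn))).symm
  obtain ⟨p, hp⟩ := key a ha
  obtain ⟨r, hr⟩ := key b hb
  refine ⟨p, r, fun h0 => hψ1 ?_, ?_⟩
  · rw [← inv_mul_cancel₀ hj, ← hr j, h0, coeff_zero]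
  · ext n
    rw [PowerSeries.coeff_mul, coeff_coe, hp, ← h, PowerSeries.coeff_mul, Finset.mul_sum, map_sum]
    refine Finset.sum_congr rfl fun i _ => ?_
    rw [coeff_coe, hr, PowerSeries.coeff_map, ← mul_assoc, mul_comm _ (algebraMap F (CInf F) _),
      ← Algebra.smul_def, map_smul, smul_eq_mul, mul_comm]

/-- A power series over `𝕂` fixed by `σ` has coefficients in `F`. -/
theorem exists_map_eq_of_map_sigma_eq {g : PowerSeries (CInf F)}
    (h : g.map (sigmaCInf F : CInf F →+* CInf F) = g) :
    ∃ c : PowerSeries F, c.map (algebraMap F (CInf F)) = g := by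
  have h' : ∀ n, sigmaCInf F (PowerSeries.coeff n g) = PowerSeries.coeff n g := fun n => by
    conv_rhs => rw [← h]
    rfl
  choose c hc using fun n => exists_algebraMap_eq_of_sigmaCInf_eq F (h' n)
  exact ⟨.mk c, PowerSeries.ext fun n => by simp [hc]⟩

theorem sigmaL_algebraMap_tate (a : Tate F) :
    sigmaL F (algebraMap (Tate F) (LL F) a) = algebraMap (Tate F) (LL F) (sigmaTate F a) :=
  IsFractionRing.ringEquivOfRingEquiv_algebraMap (sigmaTate F) a

theorem polyToTate_map_const (p : F[X]) :
    (polyToTate F (p.map (constToKBar F)) : PowerSeries (CInf F)) =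
      (p : PowerSeries F).map (algebraMap F (CInf F)) := by
  ext n
  change PowerSeries.coeff n
    (((p.map (constToKBar F)).map (kBar F).subtype : (CInf F)[X]) : PowerSeries (CInf F)) = _
  simp only [coeff_coe, coeff_map, PowerSeries.coeff_map]
  rfl

theorem algebraMap_ratFunc_LL (p : F[X]) :
    algebraMap (RatFunc F) (LL F) (algebraMap F[X] (RatFunc F) p) =
      algebraMap (Tate F) (LL F) (polyToTate F (p.map (constToKBar F))) := by
  rw [IsScalarTower.algebraMap_apply (RatFunc F) (kBarT F) (LL F), algebraMap_ratFunc_kBarT,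
    algebraMap_poly_LL]

/-- The field of `σ`-invariants in `𝕃` is `𝔽_q(t)`. -/
theorem exists_algebraMap_eq_of_sigmaL_eq {f : LL F} (hf : sigmaL F f = f) :
    ∃ c : RatFunc F, algebraMap (RatFunc F) (LL F) c = f := by
  obtain ⟨a, b, hb, rfl⟩ := IsFractionRing.div_surjective (A := Tate F) f
  have hb0 : b ≠ 0 := nonZeroDivisors.ne_zero hb
  have hinj : Function.Injective (algebraMap (Tate F) (LL F)) := IsFractionRing.injective _ _
  have hbL : algebraMap (Tate F) (LL F) b ≠ 0 := (map_ne_zero_iff _ hinj).2 hb0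
  have hsb : algebraMap (Tate F) (LL F) (sigmaTate F b) ≠ 0 :=
    (map_ne_zero_iff _ hinj).2 ((map_ne_zero_iff _ (sigmaTate F).injective).2 hb0)
  have hb0' : (b : PowerSeries (CInf F)) ≠ 0 := fun h => hb0 (Subtype.ext h)
  -- Cross-multiplied, invariance of `a / b` is an identity of power series.
  have hcross : (b : PowerSeries (CInf F)) *
      (a : PowerSeries (CInf F)).map (sigmaCInf F : CInf F →+* CInf F) =
      a * (b : PowerSeries (CInf F)).map (sigmaCInf F : CInf F →+* CInf F) := by
    rw [map_div₀, sigmaL_algebraMap_tate, sigmaL_algebraMap_tate, div_eq_div_iff hsb hbL,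
      ← map_mul, ← map_mul] at hf
    have := congrArg Subtype.val (hinj hf)
    rw [mul_comm]
    exact this
  set n := (b : PowerSeries (CInf F)).order.toNat
  set b' := (b : PowerSeries (CInf F)).divXPowOrder
  have hbb' : (PowerSeries.X : PowerSeries (CInf F)) ^ n * b' = b :=
    PowerSeries.X_pow_order_mul_divXPowOrder
  have hcst : PowerSeries.constantCoeff b' ≠ 0 := by
    rwa [Ne, PowerSeries.constantCoeff_divXPowOrder_eq_zero_iff]
  have hb'0 : b' ≠ 0 := fun h => hcst (by rw [h, map_zero])
  have hbg : b' * (b'⁻¹ * (a : PowerSeries (CInf F))) = a := by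
    rw [← mul_assoc, PowerSeries.mul_inv_cancel _ hcst, one_mul]
  -- `g = t ^ n * (a / b)`
  generalize b'⁻¹ * (a : PowerSeries (CInf F)) = g at hbg
  obtain ⟨c, rfl⟩ : ∃ c : PowerSeries F, c.map (algebraMap F (CInf F)) = g := by
    refine exists_map_eq_of_map_sigma_eq ?_
    have hX : (PowerSeries.X : PowerSeries (CInf F)) ^ n ≠ 0 := pow_ne_zero _ PowerSeries.X_ne_zero
    have hsb' : b'.map (sigmaCInf F : CInf F →+* CInf F) ≠ 0 := by
      rwa [Ne, ← map_zero (PowerSeries.map (sigmaCInf F : CInf F →+* CInf F)),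
        (PowerSeries.map_injective _ (sigmaCInf F).injective).eq_iff]
    rw [← hbb', ← hbg] at hcross
    simp only [map_mul, map_pow, PowerSeries.map_X] at hcross
    apply mul_left_cancel₀ hb'0
    apply mul_left_cancel₀ hsb'
    apply mul_left_cancel₀ hX
    linear_combination hcross
  have hXn : (PowerSeries.X : PowerSeries (CInf F)) ^ n =
      (polyToTate F ((X ^ n : F[X]).map (constToKBar F)) : PowerSeries (CInf F)) := by
    rw [polyToTate_map_const]
    simp
  have hmul : (b : PowerSeries (CInf F)) * c.map (algebraMap F (CInf F)) =
      (PowerSeries.X : PowerSeries (CInf F)) ^ n * a := by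
    rw [← hbb', mul_assoc, hbg]
  obtain ⟨p, r, hr, hrc⟩ := exists_polynomial_mul_eq
    (by rw [hXn]; exact mul_mem (Subtype.property _) a.2) b.2 hb0' hmul
  refine ⟨algebraMap F[X] (RatFunc F) p / algebraMap F[X] (RatFunc F) (r * X ^ n), ?_⟩
  have hden : algebraMap (RatFunc F) (LL F) (algebraMap F[X] (RatFunc F) (r * X ^ n)) ≠ 0 := by
    rw [Ne, map_eq_zero, map_eq_zero_iff _ (IsFractionRing.injective F[X] (RatFunc F))]
    exact mul_ne_zero hr (pow_ne_zero _ X_ne_zero)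
  rw [map_div₀, div_eq_div_iff hden hbL, algebraMap_ratFunc_LL, algebraMap_ratFunc_LL, ← map_mul,
    ← map_mul]
  refine congrArg _ (Subtype.ext ?_)
  rw [Polynomial.map_mul, map_mul]
  change (polyToTate F (p.map (constToKBar F)) : PowerSeries (CInf F)) * b = a *
    ((polyToTate F (r.map (constToKBar F)) : PowerSeries (CInf F)) *
      (polyToTate F ((X ^ n : F[X]).map (constToKBar F)) : PowerSeries (CInf F)))
  rw [← hXn, polyToTate_map_const, polyToTate_map_const, ← hrc, map_mul]
  linear_combination ((r : PowerSeries F).map (algebraMap F (CInf F))) * hmul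

/-- The field of `σ`-invariants in `k̄(t)` is `𝔽_q(t)`. -/
theorem exists_algebraMap_eq_of_sigmaT_eq {f : kBarT F} (hf : sigmaT F f = f) :
    ∃ c : RatFunc F, algebraMap (RatFunc F) (kBarT F) c = f := by
  obtain ⟨c, hc⟩ := exists_algebraMap_eq_of_sigmaL_eq (f := algebraMap (kBarT F) (LL F) f)
    (by rw [sigmaL_algebraMap, hf])
  exact ⟨c, (algebraMap (kBarT F) (LL F)).injective hc⟩

end FixedField

/-! ### Invariants of semilinear operators -/

/-- Artin's lemma: vectors fixed by a semilinear operator that are linearly independent over the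
fixed field of the scalars are linearly independent. -/
theorem linearIndependent_of_fixed {K L V ι : Type*} [Field K] [Field L] [Algebra K L]
    [AddCommGroup V] [Module L V] [Module K V] [IsScalarTower K L V] (s : L →+* L) (S : V →+ V)
    (hS : ∀ l v, S (l • v) = s l • S v)
    (hfix : ∀ l, s l = l → ∃ c : K, algebraMap K L c = l) {v : ι → V} (hv : ∀ i, S (v i) = v i)
    (hlin : LinearIndependent K v) : LinearIndependent L v := by
  classical
  rw [linearIndependent_iff']
  intro t
  induction t using Finset.induction_on with
  | empty => simp
  | insert a t ha ih =>
    intro g hg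
    have hga : g a = 0 := by
      by_contra hne
      -- Normalize the coefficient of `v a` to `1`; applying `S - 1` then shortens the relation.
      set g' : ι → L := fun i => (g a)⁻¹ * g i
      have hga' : g' a = 1 := inv_mul_cancel₀ hne
      have h1 : ∑ i ∈ insert a t, g' i • v i = 0 := by
        simp only [g', mul_smul, ← Finset.smul_sum, hg, smul_zero]
      have h2 : ∑ i ∈ insert a t, s (g' i) • v i = 0 := by
        have := congrArg S h1
        simpa only [map_sum, hS, hv, map_zero] using this
      have h3 : ∑ i ∈ t, (s (g' i) - g' i) • v i = 0 := by
        rw [Finset.sum_insert ha, hga'] at h1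
        rw [Finset.sum_insert ha, hga', map_one] at h2
        simp only [sub_smul, Finset.sum_sub_distrib]
        rw [eq_neg_of_add_eq_zero_right h1, eq_neg_of_add_eq_zero_right h2, sub_self]
      have h4 : ∀ i ∈ insert a t, ∃ c : K, algebraMap K L c = g' i := fun i hi => by
        rcases Finset.mem_insert.1 hi with rfl | hi
        · exact ⟨1, by rw [map_one, hga']⟩
        · exact hfix _ (sub_eq_zero.1 (ih _ h3 i hi))
      choose! c hc using h4
      have h5 : ∑ i ∈ insert a t, c i • v i = 0 := by
        rw [← h1]
        exact Finset.sum_congr rfl fun i hi => by rw [← hc i hi, algebraMap_smul]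
      have h6 := linearIndependent_iff'.1 hlin _ _ h5 a (Finset.mem_insert_self a t)
      have h7 := hc a (Finset.mem_insert_self a t)
      rw [h6, map_zero, hga'] at h7
      exact zero_ne_one h7
    rw [Finset.sum_insert ha, hga, zero_smul, zero_add] at hg
    intro i hi
    rcases Finset.mem_insert.1 hi with rfl | hi
    · exact hga
    · exact ih g hg i hi

/-- For a `K`-subspace `W` of fixed vectors the natural map `L ⊗ W → V` is injective. -/
theorem liftBaseChange_injective_of_fixed {K L V : Type*} [Field K] [Field L] [Algebra K L]
    [AddCommGroup V] [Module L V] [Module K V] [IsScalarTower K L V] (s : L →+* L) (S : V →+ V)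
    (hS : ∀ l v, S (l • v) = s l • S v)
    (hfix : ∀ l, s l = l → ∃ c : K, algebraMap K L c = l) (W : Submodule K V)
    (hW : ∀ x ∈ W, S x = x) : Function.Injective (LinearMap.liftBaseChange L W.subtype) := by
  let b := Module.Free.chooseBasis K W
  have h : LinearMap.liftBaseChange L W.subtype =
      (b.baseChange L).constr L fun i => (b i : V) := by
    refine (b.baseChange L).ext fun i => ?_
    rw [Module.Basis.constr_basis, Module.Basis.baseChange_apply, LinearMap.liftBaseChange_tmul,
      one_smul, Submodule.subtype_apply]
  rw [h]
  exact Module.Basis.injective_constr_of_linearIndependent _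
    (linearIndependent_of_fixed s S hS hfix (fun i => hW _ (b i).2)
      (b.linearIndependent.map' W.subtype W.ker_subtype))

namespace PreTMotive

variable {F : Type u} [Field F] [Fintype F]

theorem mem_betti {P : PreTMotive F} {x : P.Dagger} : x ∈ P.betti ↔ P.daggerSigma x = x := Iff.rfl

theorem daggerSigma_smul (P : PreTMotive F) (l : LL F) (x : P.Dagger) :
    P.daggerSigma (l • x) = sigmaL F l • P.daggerSigma x := by
  induction x using TensorProduct.induction_on with
  | zero => simp only [smul_zero, map_zero]
  | add x y hx hy => simp only [smul_add, map_add, hx, hy]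
  | tmul f m =>
    rw [smul_tmul', daggerSigma_tmul, daggerSigma_tmul, smul_tmul', smul_eq_mul, smul_eq_mul,
      map_mul]

/-- The comparison map `𝕃 ⊗ P^B → P†` is always injective. -/
theorem bettiComparison_injective (P : PreTMotive F) : Function.Injective P.bettiComparison :=
  liftBaseChange_injective_of_fixed (sigmaL F : LL F →+* LL F) P.daggerSigma.toAddMonoidHom
    P.daggerSigma_smul (fun _ => exists_algebraMap_eq_of_sigmaL_eq) P.betti fun _ h => h

theorem bettiComparison_tmul (P : PreTMotive F) (l : LL F) (x : P.betti) :
    P.bettiComparison (l ⊗ₜ x) = l • x.1 := rfl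

theorem bettiComparison_baseChange {P Q : PreTMotive F} (f : P ⟶ Q)
    (x : LL F ⊗[RatFunc F] P.betti) :
    Q.bettiComparison ((bettiMap f).baseChange (LL F) x) =
      f.1.baseChange (LL F) (P.bettiComparison x) := by
  induction x using TensorProduct.induction_on with
  | zero => simp only [map_zero]
  | add x y hx hy => simp only [map_add, hx, hy]
  | tmul l m => exact ((f.1.baseChange (LL F)).map_smul l m.1).symm

theorem isRAT_of_surjective {P : PreTMotive F} (h : Function.Surjective P.bettiComparison) :
    isRAT F P :=
  ⟨P.bettiComparison_injective, h⟩

/-! ### Exactness of `P ↦ P^B` and closure properties of rigid analytic triviality -/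

theorem baseChange_exact {P Q T : PreTMotive F} {f : P ⟶ Q} {g : Q ⟶ T}
    (h : Function.Exact f.1 g.1) :
    Function.Exact (f.1.baseChange (LL F)) (g.1.baseChange (LL F)) :=
  Module.Flat.lTensor_exact (LL F) h

theorem baseChange_injective {P Q : PreTMotive F} {f : P ⟶ Q} (h : Function.Injective f.1) :
    Function.Injective (f.1.baseChange (LL F)) :=
  Module.Flat.lTensor_preserves_injective_linearMap f.1 h

theorem baseChange_surjective {P Q : PreTMotive F} {f : P ⟶ Q} (h : Function.Surjective f.1) :
    Function.Surjective (f.1.baseChange (LL F)) :=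
  LinearMap.lTensor_surjective (LL F) h

/-- On rigid analytically trivial objects `P ↦ P^B` is exact, since after the faithfully flat base
change to `𝕃` it becomes `P ↦ P†`. -/
theorem bettiMap_exact {P Q T : PreTMotive F} (hP : isRAT F P) (hQ : isRAT F Q)
    {f : P ⟶ Q} {g : Q ⟶ T} (h : Function.Exact f.1 g.1) :
    Function.Exact (bettiMap f) (bettiMap g) := by
  refine (Module.FaithfullyFlat.lTensor_exact_iff_exact (RatFunc F) (LL F) (N1 := P.betti)
    (N2 := Q.betti) (N3 := T.betti) (bettiMap f) (bettiMap g)).1 fun y => ?_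
  change (bettiMap g).baseChange (LL F) y = 0 ↔ ∃ z, (bettiMap f).baseChange (LL F) z = y
  rw [← map_eq_zero_iff T.bettiComparison T.bettiComparison_injective, bettiComparison_baseChange,
    baseChange_exact h]
  simp only [← hQ.1.eq_iff, bettiComparison_baseChange]
  exact hP.2.exists

/-- `P ↦ P^B` is left exact on all pre-`t`-motives. -/
theorem bettiMap_exact_of_injective {P Q T : PreTMotive F} {f : P ⟶ Q} {g : Q ⟶ T}
    (hf : Function.Injective f.1) (h : Function.Exact f.1 g.1) :
    Function.Exact (bettiMap f) (bettiMap g) := by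
  have hf' := baseChange_injective hf
  intro y
  have hy : bettiMap g y = 0 ↔ g.1.baseChange (LL F) y.1 = 0 := Subtype.ext_iff
  rw [hy, baseChange_exact h]
  constructor
  · rintro ⟨x, hx⟩
    refine ⟨⟨x, hf' ?_⟩, Subtype.ext hx⟩
    rw [← daggerSigma_baseChange, hx]
    exact y.2
  · rintro ⟨x, hx⟩
    exact ⟨x.1, congrArg Subtype.val hx⟩

/-- A subobject of a rigid analytically trivial object is rigid analytically trivial. -/
theorem isRAT_of_injective {P Q T : PreTMotive F} (hQ : isRAT F Q) {f : P ⟶ Q} {g : Q ⟶ T}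
    (hf : Function.Injective f.1) (h : Function.Exact f.1 g.1) : isRAT F P := by
  refine isRAT_of_surjective fun x => ?_
  obtain ⟨y, hy⟩ := hQ.2 (f.1.baseChange (LL F) x)
  have hgy : (bettiMap g).baseChange (LL F) y = 0 := by
    apply T.bettiComparison_injective
    rw [bettiComparison_baseChange, hy, map_zero]
    exact (baseChange_exact h).apply_apply_eq_zero x
  obtain ⟨z, hz⟩ := (Module.Flat.lTensor_exact (R := RatFunc F) (N := P.betti) (N' := Q.betti)
    (N'' := T.betti) (LL F) (bettiMap_exact_of_injective hf h) y).1 hgy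
  refine ⟨z, baseChange_injective hf ?_⟩
  rw [← hy, ← bettiComparison_baseChange]
  exact congrArg _ hz

/-- A quotient of a rigid analytically trivial object is rigid analytically trivial. -/
theorem isRAT_of_surjective_hom {P Q : PreTMotive F} (hP : isRAT F P) {f : P ⟶ Q}
    (hf : Function.Surjective f.1) : isRAT F Q := by
  refine isRAT_of_surjective fun x => ?_
  obtain ⟨y, rfl⟩ := baseChange_surjective hf x
  obtain ⟨z, rfl⟩ := hP.2 y
  exact ⟨_, bettiComparison_baseChange f z⟩

/-- A direct sum of two rigid analytically trivial objects is rigid analytically trivial; of the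
biproduct identities only `h` matters. -/
theorem isRAT_of_total {P Q T : PreTMotive F} (hP : isRAT F P) (hQ : isRAT F Q) {p : T ⟶ P}
    {q : T ⟶ Q} {i : P ⟶ T} {j : Q ⟶ T} (h : p ≫ i + q ≫ j = 𝟙 T) : isRAT F T := by
  refine isRAT_of_surjective fun x => ?_
  obtain ⟨y, hy⟩ := hP.2 (p.1.baseChange (LL F) x)
  obtain ⟨z, hz⟩ := hQ.2 (q.1.baseChange (LL F) x)
  refine ⟨(bettiMap i).baseChange (LL F) y + (bettiMap j).baseChange (LL F) z, ?_⟩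
  have h' : i.1 ∘ₗ p.1 + j.1 ∘ₗ q.1 = LinearMap.id := congrArg Subtype.val h
  rw [map_add, bettiComparison_baseChange, bettiComparison_baseChange, hy, hz,
    ← LinearMap.comp_apply, ← LinearMap.comp_apply, ← LinearMap.baseChange_comp,
    ← LinearMap.baseChange_comp, ← LinearMap.add_apply, ← LinearMap.baseChange_add, h',
    LinearMap.baseChange_id, LinearMap.id_apply]

/-- `P ↦ P^B` is faithful on rigid analytically trivial objects. -/
theorem bettiMap_injective {P Q : PreTMotive F} (hP : isRAT F P) {f g : P ⟶ Q}
    (h : bettiMap f = bettiMap g) : f = g := by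
  have hfg : f.1.baseChange (LL F) = g.1.baseChange (LL F) := by
    refine LinearMap.ext fun x => ?_
    obtain ⟨y, rfl⟩ := hP.2 x
    rw [← bettiComparison_baseChange, h, bettiComparison_baseChange]
  refine Subtype.ext (LinearMap.ext fun m => ?_)
  apply Module.FaithfullyFlat.tensorProduct_mk_injective (A := kBarT F) (B := LL F) Q
  exact LinearMap.congr_fun hfg (1 ⊗ₜ m)

end PreTMotive

/-! ### Difference modules form an abelian category -/

attribute [local instance] RingHomInvPair.of_ringEquiv RingHomInvPair.of_ringEquiv_symm

namespace DiffModule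

open Limits

variable {R : Type u} [Field R] {s : R ≃+* R}

/-- The restriction of `σ` to a `σ`-stable subspace. -/
def sub (P : DiffModule R s) (W : Submodule R P) (h : ∀ x, P.sigma x ∈ W ↔ x ∈ W) :
    DiffModule R s where
  carrier := W
  sigma :=
    { toFun := fun x => ⟨P.sigma x.1, (h _).2 x.2⟩
      map_add' := fun x y => Subtype.ext (map_add P.sigma x.1 y.1)
      map_smul' := fun c x => Subtype.ext (map_smulₛₗ P.sigma c x.1)
      invFun := fun x => ⟨P.sigma.symm x.1, (h _).1 (by rw [P.sigma.apply_symm_apply]; exact x.2)⟩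
      left_inv := fun x => Subtype.ext (P.sigma.symm_apply_apply x.1)
      right_inv := fun x => Subtype.ext (P.sigma.apply_symm_apply x.1) }

/-- The quotient by a `σ`-stable subspace. -/
def quotient (P : DiffModule R s) (W : Submodule R P) (h : ∀ x, P.sigma x ∈ W ↔ x ∈ W) :
    DiffModule R s where
  carrier := P ⧸ W
  sigma := Submodule.Quotient.equiv W W P.sigma (by
    ext y
    rw [Submodule.mem_map]
    constructor
    · rintro ⟨x, hx, rfl⟩
      exact (h x).2 hx
    · intro hy
      refine ⟨P.sigma.symm y, (h _).1 ?_, ?_⟩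
      · rwa [P.sigma.apply_symm_apply]
      · exact P.sigma.apply_symm_apply y)

variable {P Q T : DiffModule R s}

theorem sigma_mem_ker (f : P ⟶ Q) (x : P) :
    P.sigma x ∈ LinearMap.ker f.1 ↔ x ∈ LinearMap.ker f.1 := by
  rw [LinearMap.mem_ker, LinearMap.mem_ker, f.2, map_eq_zero_iff _ Q.sigma.injective]

theorem sigma_mem_range (f : P ⟶ Q) (y : Q) :
    Q.sigma y ∈ LinearMap.range f.1 ↔ y ∈ LinearMap.range f.1 := by
  constructor
  · rintro ⟨x, hx⟩
    refine ⟨P.sigma.symm x, Q.sigma.injective ?_⟩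
    rw [← f.2, P.sigma.apply_symm_apply, hx]
  · rintro ⟨x, rfl⟩
    exact ⟨P.sigma x, f.2 x⟩

theorem comp_eq_zero_iff {f : P ⟶ Q} {g : Q ⟶ T} : f ≫ g = 0 ↔ ∀ x, g.1 (f.1 x) = 0 :=
  Subtype.ext_iff.trans LinearMap.ext_iff

/-- The kernel of a homomorphism. -/
def kernelFork (f : P ⟶ Q) : KernelFork f :=
  KernelFork.ofι (Z := P.sub (LinearMap.ker f.1) (sigma_mem_ker f))
    ⟨(LinearMap.ker f.1).subtype, fun _ => rfl⟩ (comp_eq_zero_iff.2 fun x => x.2)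

def kernelForkIsLimit (f : P ⟶ Q) : IsLimit (kernelFork f) :=
  KernelFork.IsLimit.ofι _ (kernelFork f).condition
    (fun {W} g w => show W ⟶ P.sub _ (sigma_mem_ker f) from
      ⟨LinearMap.codRestrict _ g.1 (comp_eq_zero_iff.1 w), fun x => Subtype.ext (g.2 x)⟩)
    (fun _ _ => rfl)
    (fun _ _ _ h => Subtype.ext (LinearMap.ext fun x => Subtype.ext
      (LinearMap.congr_fun (congrArg Subtype.val h) x)))

/-- The cokernel of a homomorphism. -/
def cokernelCofork (f : P ⟶ Q) : CokernelCofork f :=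
  CokernelCofork.ofπ (Z := Q.quotient (LinearMap.range f.1) (sigma_mem_range f))
    ⟨(LinearMap.range f.1).mkQ, fun _ => rfl⟩
    (comp_eq_zero_iff.2 fun x => (Submodule.Quotient.mk_eq_zero _).2 ⟨x, rfl⟩)

def cokernelCoforkIsColimit (f : P ⟶ Q) : IsColimit (cokernelCofork f) :=
  CokernelCofork.IsColimit.ofπ _ (cokernelCofork f).condition
    (fun {W} g w => show Q.quotient _ (sigma_mem_range f) ⟶ W from
      ⟨(LinearMap.range f.1).liftQ g.1 (by
        rintro _ ⟨x, rfl⟩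
        exact comp_eq_zero_iff.1 w x), fun x => by
      obtain ⟨y, rfl⟩ := Submodule.Quotient.mk_surjective _ x
      exact g.2 y⟩)
    (fun _ _ => rfl)
    (fun _ _ _ h => Subtype.ext (LinearMap.ext fun x => by
      obtain ⟨y, rfl⟩ := Submodule.Quotient.mk_surjective _ x
      exact LinearMap.congr_fun (congrArg Subtype.val h) y))

instance : HasKernels (DiffModule R s) := ⟨fun f => ⟨_, kernelForkIsLimit f⟩⟩

instance : HasCokernels (DiffModule R s) := ⟨fun f => ⟨_, cokernelCoforkIsColimit f⟩⟩

instance (f : P ⟶ Q) : PreservesLimit (parallelPair f 0) (forgetful R s) :=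
  preservesLimit_of_preserves_limit_cone (kernelForkIsLimit f)
    ((KernelFork.isLimitMapConeEquiv _ _).symm (ModuleCat.kernelIsLimit ((forgetful R s).map f)))

instance (f : P ⟶ Q) : PreservesColimit (parallelPair f 0) (forgetful R s) :=
  preservesColimit_of_preserves_colimit_cocone (cokernelCoforkIsColimit f)
    ((CokernelCofork.isColimitMapCoconeEquiv _ _).symm
      (ModuleCat.cokernelIsColimit ((forgetful R s).map f)))

variable (R s) in
/-- The zero object. -/
def zero : DiffModule R s where
  carrier := PUnit
  sigma :=
    { toFun := id
      invFun := id
      map_add' := fun _ _ => rfl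
      map_smul' := fun _ _ => rfl
      left_inv := fun _ => rfl
      right_inv := fun _ => rfl }

theorem isZero_zero : IsZero (zero R s) := by
  rw [IsZero.iff_id_eq_zero]
  exact Subtype.ext (LinearMap.ext fun _ => rfl)

instance : HasZeroObject (DiffModule R s) := ⟨zero R s, isZero_zero⟩

/-- The direct sum of two difference modules. -/
def prod (P Q : DiffModule R s) : DiffModule R s where
  carrier := P × Q
  sigma :=
    { P.sigma.toAddEquiv.prodCongr Q.sigma.toAddEquiv with
      map_smul' := fun c x => Prod.ext (map_smulₛₗ P.sigma c x.1) (map_smulₛₗ Q.sigma c x.2) }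

instance : HasBinaryBiproducts (DiffModule R s) where
  has_binary_biproduct P Q := hasBinaryBiproduct_of_total
    { pt := prod P Q
      fst := ⟨LinearMap.fst R P Q, fun _ => rfl⟩
      snd := ⟨LinearMap.snd R P Q, fun _ => rfl⟩
      inl := ⟨LinearMap.inl R P Q, fun _ => Prod.ext rfl (map_zero Q.sigma).symm⟩
      inr := ⟨LinearMap.inr R P Q, fun _ => Prod.ext (map_zero P.sigma).symm rfl⟩
      inl_fst := rfl
      inl_snd := rfl
      inr_fst := rfl
      inr_snd := rfl }
    (Subtype.ext (LinearMap.ext fun x => Prod.ext (add_zero x.1) (zero_add x.2)))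

instance : HasFiniteProducts (DiffModule R s) :=
  hasFiniteProducts_of_has_binary_and_terminal

instance : (forgetful R s).ReflectsIsomorphisms where
  reflects f hf := by
    have hb : Function.Bijective f.1 := ConcreteCategory.bijective_of_isIso ((forgetful R s).map f)
    exact (mkIso (LinearEquiv.ofBijective f.1 hb) f.2).isIso_hom

instance (f : P ⟶ Q) : IsIso (Abelian.coimageImageComparison f) :=
  have := IsIso.of_isIso_fac_right
    (Abelian.PreservesCoimage.hom_coimageImageComparison (forgetful R s) f).symm
  isIso_of_reflects_iso _ (forgetful R s)

instance : Abelian (DiffModule R s) := Abelian.ofCoimageImageComparisonIsIso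

instance : PreservesFiniteLimits (forgetful R s) :=
  (forgetful R s).preservesFiniteLimits_of_preservesKernels

instance : PreservesFiniteColimits (forgetful R s) :=
  (forgetful R s).preservesFiniteColimits_of_preservesCokernels

theorem function_exact_of_exact {S : ShortComplex (DiffModule R s)} (hS : S.Exact) :
    Function.Exact S.f.1 S.g.1 :=
  (ShortComplex.ShortExact.moduleCat_exact_iff_function_exact _).1 (hS.map (forgetful R s))

/-! ### Duals -/

/-- The action `φ ↦ s ∘ φ ∘ σ⁻¹` of `σ` on the dual vector space. -/
def dualSigma (P : DiffModule R s) :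
    Module.Dual R P ≃ₛₗ[(s : R →+* R)] Module.Dual R P :=
  P.sigma.arrowCongr (unitSigma s)

theorem dualSigma_apply (P : DiffModule R s) (φ : Module.Dual R P) (x : P) :
    P.dualSigma φ x = s (φ (P.sigma.symm x)) := rfl

/-- The dual of a difference module. -/
def dual (P : DiffModule R s) : DiffModule R s where
  carrier := Module.Dual R P
  sigma := P.dualSigma

/-- The evaluation `φ ⊗ m ↦ φ m`. -/
def ev (P : DiffModule R s) : P.dual ⊗ P ⟶ 𝟙_ (DiffModule R s) :=
  ⟨contractLeft R P, eq_of_tmul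
    ((contractLeft R P).comp (TensorProduct.map P.dualSigma.toLinearMap P.sigma.toLinearMap))
    ((unitSigma s).toLinearMap.comp (contractLeft R P)) fun φ m => by
      change P.dualSigma φ (P.sigma m) = s (φ m)
      rw [dualSigma_apply, P.sigma.symm_apply_apply]⟩

/-- `coevaluation R P 1` is invariant, because it corresponds to the identity under
`P ⊗ P^∨ ≃ End P`, and `σ` acts on the right hand side by conjugation. -/
theorem coevaluation_sigma (P : DiffModule R s) :
    TensorProduct.congr P.sigma P.dualSigma (coevaluation R P 1) = coevaluation R P 1 := by
  let Φ : P ⊗[R] Module.Dual R P ≃ₗ[R] (P →ₗ[R] P) :=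
    TensorProduct.comm R P (Module.Dual R P) ≪≫ₗ dualTensorHomEquiv R P P
  have hΦ : ∀ (m : P) (φ : Module.Dual R P) (x : P), Φ (m ⊗ₜ φ) x = φ x • m := fun _ _ _ => rfl
  have h1 : Φ (coevaluation R P 1) = LinearMap.id := by
    refine LinearMap.ext fun x => ?_
    rw [coevaluation_apply_one, map_sum, LinearMap.sum_apply]
    simp only [hΦ]
    exact (Module.Basis.ofVectorSpace R P).sum_repr x
  have h2 : ∀ (t : P ⊗[R] Module.Dual R P) (x : P),
      Φ (TensorProduct.congr P.sigma P.dualSigma t) x = P.sigma (Φ t (P.sigma.symm x)) := by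
    intro t x
    induction t using TensorProduct.induction_on with
    | zero => simp only [map_zero, LinearMap.zero_apply]
    | add a b ha hb => simp only [map_add, LinearMap.add_apply, ha, hb]
    | tmul m φ => exact (map_smulₛₗ P.sigma (φ (P.sigma.symm x)) m).symm
  apply Φ.injective
  refine LinearMap.ext fun x => ?_
  rw [h2, h1, LinearMap.id_apply, LinearMap.id_apply, P.sigma.apply_symm_apply]

/-- The coevaluation `1 ↦ ∑ bᵢ ⊗ bᵢ^*`. -/
def coev (P : DiffModule R s) : 𝟙_ (DiffModule R s) ⟶ P ⊗ P.dual :=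
  ⟨coevaluation R P, fun (a : R) => by
    change coevaluation R P (s a) = TensorProduct.congr P.sigma P.dualSigma (coevaluation R P a)
    have h (a : R) : coevaluation R P a = a • coevaluation R P 1 := by
      rw [← map_smul, smul_eq_mul, mul_one]
    rw [h a, map_smulₛₗ, coevaluation_sigma, h]
    rfl⟩

instance (P : DiffModule R s) : ExactPairing P P.dual where
  coevaluation' := P.coev
  evaluation' := P.ev
  coevaluation_evaluation' := Subtype.ext (contractLeft_assoc_coevaluation R P)
  evaluation_coevaluation' := Subtype.ext (contractLeft_assoc_coevaluation' R P)

instance : MonoidalPreadditive (DiffModule R s) where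
  whiskerLeft_zero := Subtype.ext (TensorProduct.map_zero_right _)
  zero_whiskerRight := Subtype.ext (TensorProduct.map_zero_left _)
  whiskerLeft_add f g := Subtype.ext (TensorProduct.map_add_right _ f.1 g.1)
  add_whiskerRight f g := Subtype.ext (TensorProduct.map_add_left f.1 g.1 _)

end DiffModule

instance {F : Type u} [Field F] [Fintype F] : MonoidalLinear (RatFunc F) (PreTMotive F) where
  whiskerLeft_smul _ _ _ c f := Subtype.ext
    (TensorProduct.map_smul_right (algebraMap (RatFunc F) (kBarT F) c) _ f.1)
  smul_whiskerRight c _ _ f _ := Subtype.ext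
    (TensorProduct.map_smul_left (algebraMap (RatFunc F) (kBarT F) c) f.1 _)

/-! ### The natural pairing `P† × Q† → (P ⊗ Q)†` -/

section BasePairing

variable {K L M N M' N' T : Type*} [Field K] [Field L] [Algebra K L] [AddCommGroup M] [Module K M]
  [AddCommGroup N] [Module K N] [AddCommGroup M'] [Module K M'] [AddCommGroup N'] [Module K N']
  [AddCommGroup T] [Module K T]

variable (K L M N) in
/-- The natural pairing `(f ⊗ m, g ⊗ n) ↦ fg ⊗ (m ⊗ n)` for vector spaces.  On the spaces underlying
pre-`t`-motives it is `daggerTensor`. -/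
def basePairing : L ⊗[K] M →ₗ[L] L ⊗[K] N →ₗ[L] L ⊗[K] (M ⊗[K] N) :=
  (TensorProduct.mk L (L ⊗[K] M) (L ⊗[K] N)).compr₂
    (TensorProduct.AlgebraTensorModule.distribBaseChange K L M N).symm.toLinearMap

theorem basePairing_tmul (f g : L) (m : M) (n : N) :
    basePairing K L M N (f ⊗ₜ m) (g ⊗ₜ n) = (f * g) ⊗ₜ (m ⊗ₜ n) :=
  TensorProduct.AlgebraTensorModule.distribBaseChange_symm_tmul _ _ _ _ _ _

theorem basePairing_map (φ : M →ₗ[K] M') (ψ : N →ₗ[K] N') (x : L ⊗[K] M) (y : L ⊗[K] N) :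
    (TensorProduct.map φ ψ).baseChange L (basePairing K L M N x y) =
      basePairing K L M' N' (φ.baseChange L x) (ψ.baseChange L y) := by
  induction x using TensorProduct.induction_on with
  | zero => simp only [map_zero, LinearMap.zero_apply]
  | add x x' hx hx' => simp only [map_add, LinearMap.add_apply, hx, hx']
  | tmul f m =>
    induction y using TensorProduct.induction_on with
    | zero => simp only [map_zero]
    | add y y' hy hy' => simp only [map_add, hy, hy']
    | tmul g n => simp only [basePairing_tmul, LinearMap.baseChange_tmul, TensorProduct.map_tmul]

theorem basePairing_comm (x : L ⊗[K] M) (y : L ⊗[K] N) :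
    (TensorProduct.comm K M N).toLinearMap.baseChange L (basePairing K L M N x y) =
      basePairing K L N M y x := by
  induction x using TensorProduct.induction_on with
  | zero => simp only [map_zero, LinearMap.zero_apply]
  | add x x' hx hx' => simp only [map_add, LinearMap.add_apply, hx, hx']
  | tmul f m =>
    induction y using TensorProduct.induction_on with
    | zero => simp only [map_zero, LinearMap.zero_apply]
    | add y y' hy hy' => simp only [map_add, LinearMap.add_apply, hy, hy']
    | tmul g n =>
      simp only [basePairing_tmul, LinearMap.baseChange_tmul, LinearEquiv.coe_coe,
        TensorProduct.comm_tmul, mul_comm]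

theorem basePairing_assoc (x : L ⊗[K] M) (y : L ⊗[K] N) (z : L ⊗[K] T) :
    (TensorProduct.assoc K M N T).toLinearMap.baseChange L
        (basePairing K L (M ⊗[K] N) T (basePairing K L M N x y) z) =
      basePairing K L M (N ⊗[K] T) x (basePairing K L N T y z) := by
  induction x using TensorProduct.induction_on with
  | zero => simp only [map_zero, LinearMap.zero_apply]
  | add x x' hx hx' => simp only [map_add, LinearMap.add_apply, hx, hx']
  | tmul f m =>
    induction y using TensorProduct.induction_on with
    | zero => simp only [map_zero, LinearMap.zero_apply]
    | add y y' hy hy' => simp only [map_add, LinearMap.add_apply, hy, hy']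
    | tmul g n =>
      induction z using TensorProduct.induction_on with
      | zero => simp only [map_zero]
      | add z z' hz hz' => simp only [map_add, hz, hz']
      | tmul h t =>
        simp only [basePairing_tmul, LinearMap.baseChange_tmul, LinearEquiv.coe_coe,
          TensorProduct.assoc_tmul, mul_assoc]

theorem basePairing_lid (l : L) (y : L ⊗[K] N) :
    (TensorProduct.lid K N).toLinearMap.baseChange L (basePairing K L K N (l ⊗ₜ 1) y) = l • y := by
  induction y using TensorProduct.induction_on with
  | zero => simp only [map_zero, smul_zero]
  | add y y' hy hy' => simp only [map_add, hy, hy', smul_add]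
  | tmul g n =>
    simp only [basePairing_tmul, LinearMap.baseChange_tmul, LinearEquiv.coe_coe,
      TensorProduct.lid_tmul, one_smul, smul_tmul', smul_eq_mul]

theorem basePairing_rid (l : L) (x : L ⊗[K] M) :
    (TensorProduct.rid K M).toLinearMap.baseChange L (basePairing K L M K x (l ⊗ₜ 1)) = l • x := by
  induction x using TensorProduct.induction_on with
  | zero => simp only [map_zero, LinearMap.zero_apply, smul_zero]
  | add x x' hx hx' => simp only [map_add, LinearMap.add_apply, hx, hx', smul_add]
  | tmul f m =>
    simp only [basePairing_tmul, LinearMap.baseChange_tmul, LinearEquiv.coe_coe,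
      TensorProduct.rid_tmul, one_smul, smul_tmul', smul_eq_mul, mul_comm]

end BasePairing

namespace PreTMotive

variable {F : Type u} [Field F] [Fintype F]

/-! ### The tensor structure on rigid analytically trivial objects -/

theorem daggerSigma_basePairing {P Q : PreTMotive F} (x : P.Dagger) (y : Q.Dagger) :
    (P ⊗ Q : PreTMotive F).daggerSigma (basePairing (kBarT F) (LL F) P Q x y) =
      basePairing (kBarT F) (LL F) P Q (P.daggerSigma x) (Q.daggerSigma y) := by
  induction x using TensorProduct.induction_on with
  | zero => simp only [map_zero, LinearMap.zero_apply]; exact map_zero _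
  | add x x' hx hx' =>
    simp only [map_add, LinearMap.add_apply, ← hx, ← hx']
    exact map_add _ _ _
  | tmul f m =>
    induction y using TensorProduct.induction_on with
    | zero => simp only [map_zero]; exact map_zero _
    | add y y' hy hy' =>
      simp only [map_add, ← hy, ← hy']
      exact map_add _ _ _
    | tmul g n =>
      rw [daggerSigma_tmul, daggerSigma_tmul, basePairing_tmul, basePairing_tmul, ← map_mul]
      rfl

/-- The natural map `P^B ⊗ Q^B → (P ⊗ Q)^B`. -/
def bettiTensor (P Q : PreTMotive F) :
    P.betti ⊗[RatFunc F] Q.betti →ₗ[RatFunc F] (P ⊗ Q : PreTMotive F).betti :=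
  TensorProduct.lift (LinearMap.mk₂ (RatFunc F)
    (fun x y => (⟨basePairing (kBarT F) (LL F) P Q x.1 y.1, by
      refine (daggerSigma_basePairing x.1 y.1).trans ?_
      rw [mem_betti.1 x.2, mem_betti.1 y.2]⟩ : (P ⊗ Q : PreTMotive F).betti))
    (fun x x' y => Subtype.ext (LinearMap.map_add₂ (basePairing (kBarT F) (LL F) P Q) x.1 x'.1 y.1))
    (fun c x y => Subtype.ext (by
      change basePairing (kBarT F) (LL F) P Q (c • x.1) y.1 =
        c • basePairing (kBarT F) (LL F) P Q x.1 y.1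
      rw [← algebraMap_smul (LL F) c x.1, LinearMap.map_smul₂, algebraMap_smul]))
    (fun x y y' => Subtype.ext (map_add (basePairing (kBarT F) (LL F) P Q x.1) y.1 y'.1))
    (fun c x y => Subtype.ext (by
      change basePairing (kBarT F) (LL F) P Q x.1 (c • y.1) =
        c • basePairing (kBarT F) (LL F) P Q x.1 y.1
      rw [← algebraMap_smul (LL F) c y.1, map_smul, algebraMap_smul])))

theorem bettiTensor_tmul {P Q : PreTMotive F} (x : P.betti) (y : Q.betti) :
    (bettiTensor P Q (x ⊗ₜ y)).1 = daggerTensor x.1 y.1 := rfl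

/-- Surjectivity descends from `L` to `K` by faithful flatness, and injectivity follows by comparing
dimensions. -/
theorem bijective_of_baseChange_surjective {K : Type*} (L : Type*) {V₁ V₂ V₃ : Type*} [Field K]
    [Field L] [Algebra K L] [AddCommGroup V₁] [Module K V₁] [AddCommGroup V₂] [Module K V₂]
    [AddCommGroup V₃] [Module K V₃] {W₁ : Submodule K V₁} {W₂ : Submodule K V₂}
    {W₃ : Submodule K V₃} [Module.Finite K W₁] [Module.Finite K W₂] [Module.Finite K W₃]
    (f : W₁ ⊗[K] W₂ →ₗ[K] W₃)
    (hrank : Module.finrank K W₁ * Module.finrank K W₂ = Module.finrank K W₃)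
    (hf : Function.Surjective (f.baseChange L)) : Function.Bijective f := by
  have h : Function.Surjective f :=
    (Module.FaithfullyFlat.lTensor_surjective_iff_surjective K L f).1 hf
  refine ⟨(LinearMap.injective_iff_surjective_of_finrank_eq_finrank ?_).2 h, h⟩
  rw [Module.finrank_tensorProduct, hrank]

/-- Already the image of `𝕃 ⊗ (P^B ⊗ Q^B)` is all of `(P ⊗ Q)†`. -/
theorem bettiComparison_bettiTensor_surjective {P Q : PreTMotive F} (hP : isRAT F P)
    (hQ : isRAT F Q) : Function.Surjective
      ((P ⊗ Q : PreTMotive F).bettiComparison ∘ₗ (bettiTensor P Q).baseChange (LL F)) := by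
  rw [← LinearMap.range_eq_top]
  set N := LinearMap.range
    ((P ⊗ Q : PreTMotive F).bettiComparison ∘ₗ (bettiTensor P Q).baseChange (LL F))
  have h1 : ∀ (x : P.Dagger) (y : Q.Dagger), daggerTensor x y ∈ N := by
    intro x y
    obtain ⟨x, rfl⟩ := hP.2 x
    obtain ⟨y, rfl⟩ := hQ.2 y
    change basePairing (kBarT F) (LL F) P Q _ _ ∈ N
    induction x using TensorProduct.induction_on with
    | zero => simp only [map_zero, LinearMap.zero_apply]; exact N.zero_mem
    | add x x' hx hx' => simp only [map_add, LinearMap.add_apply]; exact N.add_mem hx hx'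
    | tmul l μ =>
      induction y using TensorProduct.induction_on with
      | zero => simp only [map_zero]; exact N.zero_mem
      | add y y' hy hy' => simp only [map_add]; exact N.add_mem hy hy'
      | tmul l' ν =>
        rw [bettiComparison_tmul, bettiComparison_tmul, LinearMap.map_smul₂, map_smul]
        exact N.smul_mem _ (N.smul_mem _ ⟨1 ⊗ₜ (μ ⊗ₜ ν), one_smul (LL F) _⟩)
  rw [eq_top_iff]
  intro z _
  obtain ⟨w, rfl⟩ :=
    (TensorProduct.AlgebraTensorModule.distribBaseChange (kBarT F) (LL F) P Q).symm.surjective z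
  induction w using TensorProduct.induction_on with
  | zero => rw [map_zero]; exact N.zero_mem
  | add w w' hw hw' => rw [map_add]; exact N.add_mem (hw trivial) (hw' trivial)
  | tmul x y => exact h1 x y

theorem isRAT_tensor {P Q : PreTMotive F} (hP : isRAT F P) (hQ : isRAT F Q) :
    isRAT F (P ⊗ Q : PreTMotive F) :=
  isRAT_of_surjective
    (Function.Surjective.of_comp (bettiComparison_bettiTensor_surjective hP hQ))

instance free_betti (P : PreTMotive F) : Module.Free (RatFunc F) P.betti :=
  Module.Free.of_divisionRing (RatFunc F) P.betti

theorem finrank_betti {P : PreTMotive F} (hP : isRAT F P) :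
    Module.finrank (RatFunc F) P.betti = Module.finrank (kBarT F) P := by
  rw [← Module.finrank_baseChange (R := LL F) (S := RatFunc F) (M' := P.betti),
    ← Module.finrank_baseChange (R := LL F) (S := kBarT F) (M' := P)]
  exact (LinearEquiv.ofBijective _ hP).finrank_eq

theorem bettiTensor_bijective {P Q : PreTMotive F} (hP : isRAT F P) (hQ : isRAT F Q) :
    Function.Bijective (bettiTensor P Q) := by
  have := finite_betti hP
  have := finite_betti hQ
  have := finite_betti (isRAT_tensor hP hQ)
  have hrank : Module.finrank (RatFunc F) P.betti * Module.finrank (RatFunc F) Q.betti =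
      Module.finrank (RatFunc F) (P ⊗ Q : PreTMotive F).betti := by
    rw [finrank_betti (isRAT_tensor hP hQ), finrank_betti hP, finrank_betti hQ]
    exact (Module.finrank_tensorProduct (R := kBarT F) (M := P) (M' := Q)).symm
  have hsurj : Function.Surjective ((bettiTensor P Q).baseChange (LL F)) := fun y => by
    obtain ⟨x, hx⟩ := bettiComparison_bettiTensor_surjective hP hQ
      ((P ⊗ Q : PreTMotive F).bettiComparison y)
    exact ⟨x, (P ⊗ Q : PreTMotive F).bettiComparison_injective hx⟩
  exact bijective_of_baseChange_surjective (LL F) (bettiTensor P Q) hrank hsurj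

/-! ### The identity object -/

/-- The natural map `𝔽_q(t) → 1^B`, `c ↦ c ⊗ 1`. -/
def bettiUnit (F : Type u) [Field F] [Fintype F] :
    RatFunc F →ₗ[RatFunc F] (𝟙_ (PreTMotive F)).betti :=
  LinearMap.toSpanSingleton (RatFunc F) _ ⟨(1 : LL F) ⊗ₜ[kBarT F] (1 : kBarT F), by
    rw [mem_betti]
    exact congrArg₂ (· ⊗ₜ[kBarT F] ·) (map_one (sigmaL F)) (map_one (sigmaT F))⟩

theorem bettiUnit_apply (c : RatFunc F) :
    (bettiUnit F c).1 = c • ((1 : LL F) ⊗ₜ[kBarT F] (1 : kBarT F)) := rfl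

theorem bettiUnit_eq_tmul (c : RatFunc F) :
    (bettiUnit F c).1 = algebraMap (RatFunc F) (LL F) c ⊗ₜ[kBarT F] (1 : kBarT F) := by
  rw [bettiUnit_apply, smul_tmul', Algebra.smul_def, mul_one]

theorem exists_tmul_one (x : (𝟙_ (PreTMotive F)).Dagger) :
    ∃ l : LL F, x = l ⊗ₜ[kBarT F] (1 : kBarT F) := by
  obtain ⟨l, rfl⟩ := (TensorProduct.rid (kBarT F) (LL F)).symm.surjective x
  exact ⟨l, rfl⟩

theorem isRAT_unit : isRAT F (𝟙_ (PreTMotive F)) := by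
  refine isRAT_of_surjective fun x => ?_
  obtain ⟨l, rfl⟩ := exists_tmul_one x
  refine ⟨l ⊗ₜ bettiUnit F 1, ?_⟩
  rw [bettiComparison_tmul, bettiUnit_apply, one_smul]
  exact congrArg (· ⊗ₜ[kBarT F] (1 : kBarT F)) (mul_one l)

theorem bettiUnit_bijective : Function.Bijective (bettiUnit F) := by
  have hone : Function.Injective fun l : LL F => l ⊗ₜ[kBarT F] (1 : kBarT F) :=
    (TensorProduct.rid (kBarT F) (LL F)).symm.injective
  constructor
  · intro c d h
    refine (algebraMap (RatFunc F) (LL F)).injective (hone ?_)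
    change _ ⊗ₜ[kBarT F] _ = _ ⊗ₜ[kBarT F] _
    rw [← bettiUnit_eq_tmul, ← bettiUnit_eq_tmul, h]
  · rintro ⟨x, hx⟩
    obtain ⟨l, rfl⟩ := exists_tmul_one x
    have hl : sigmaL F l = l := by
      refine hone ((?_ : _ = _).trans hx)
      exact congrArg (sigmaL F l ⊗ₜ[kBarT F] ·) (map_one (sigmaT F)).symm
    obtain ⟨c, rfl⟩ := exists_algebraMap_eq_of_sigmaL_eq hl
    exact ⟨c, Subtype.ext (bettiUnit_eq_tmul c)⟩

/-! ### Duals of rigid analytically trivial objects -/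

/-- The isomorphism of `(P^∨)†` with the dual of `P†`. -/
def daggerDual (P : PreTMotive F) :
    (LL F ⊗[kBarT F] Module.Dual (kBarT F) P) ≃ₗ[LL F] Module.Dual (LL F) P.Dagger :=
  (TensorProduct.isBaseChange (kBarT F) P (LL F)).toDualBaseChange

theorem daggerDual_tmul (P : PreTMotive F) (f g : LL F) (φ : Module.Dual (kBarT F) P) (m : P) :
    P.daggerDual (f ⊗ₜ φ) (g ⊗ₜ m) = f * g * algebraMap (kBarT F) (LL F) (φ m) := by
  have h : (g ⊗ₜ[kBarT F] m : P.Dagger) = g • TensorProduct.mk (kBarT F) (LL F) P 1 m := by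
    rw [TensorProduct.mk_apply, smul_tmul', smul_eq_mul, mul_one]
  rw [h, map_smul, daggerDual, IsBaseChange.toDualBaseChange_tmul, smul_eq_mul]
  ring

/-- The action of `σ` on `(P^∨)†`.  By definition it is `daggerSigma` of the dual of `P`, with the
dual vector space written out. -/
def daggerDualSigma (P : PreTMotive F) :
    LL F ⊗[kBarT F] Module.Dual (kBarT F) P →ₛₗ[(sigmaT F : kBarT F →+* kBarT F)]
      LL F ⊗[kBarT F] Module.Dual (kBarT F) P :=
  TensorProduct.map (sigmaLSemi F) (DiffModule.dualSigma P).toLinearMap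

theorem daggerDualSigma_tmul (P : PreTMotive F) (f : LL F) (φ : Module.Dual (kBarT F) P) :
    P.daggerDualSigma (f ⊗ₜ φ) = sigmaL F f ⊗ₜ DiffModule.dualSigma P φ := rfl

/-- The pairing of `(P^∨)†` with `P†` is compatible with `σ`. -/
theorem daggerDual_sigma (P : PreTMotive F) (y : LL F ⊗[kBarT F] Module.Dual (kBarT F) P)
    (x : P.Dagger) :
    P.daggerDual (P.daggerDualSigma y) (P.daggerSigma x) = sigmaL F (P.daggerDual y x) := by
  induction x using TensorProduct.induction_on with
  | zero => simp only [map_zero]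
  | add x x' hx hx' => simp only [map_add, hx, hx']
  | tmul g m =>
    induction y using TensorProduct.induction_on with
    | zero => simp only [map_zero, LinearMap.zero_apply]
    | add y y' hy hy' => simp only [map_add, LinearMap.add_apply, hy, hy']
    | tmul f φ =>
      rw [daggerDualSigma_tmul, daggerSigma_tmul, daggerDual_tmul, daggerDual_tmul,
        DiffModule.dualSigma_apply, P.sigma.symm_apply_apply, map_mul, map_mul, sigmaL_algebraMap]

/-- A basis of `P^B` is an `𝕃`-basis of `P†`, and the dual basis consists of invariants. -/
theorem isRAT_dual {P : PreTMotive F} (hP : isRAT F P) :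
    isRAT F (DiffModule.dual P : PreTMotive F) := by
  have := finite_betti hP
  let b := Module.finBasis (RatFunc F) P.betti
  let B : Module.Basis _ (LL F) P.Dagger :=
    (b.baseChange (LL F)).map (LinearEquiv.ofBijective P.bettiComparison hP)
  have hB : ∀ i, P.daggerSigma (B i) = B i := fun i => by
    have h : B i = (b i).1 := by
      rw [Module.Basis.map_apply, Module.Basis.baseChange_apply]
      exact (bettiComparison_tmul _ _ _).trans (one_smul _ _)
    rw [h]
    exact (b i).2
  let ν i := P.daggerDual.symm (B.dualBasis i)
  have hν : ∀ i, P.daggerDualSigma (ν i) = ν i := fun i => by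
    apply P.daggerDual.injective
    refine B.ext fun j => ?_
    -- The values `0` and `1` of `ν i` on the invariant vectors `B j` are fixed by `σ`.
    have h := daggerDual_sigma P (ν i) (B j)
    rw [hB] at h
    rw [h, LinearEquiv.apply_symm_apply, Module.Basis.dualBasis_apply_self]
    split_ifs
    · exact map_one _
    · exact map_zero _
  refine isRAT_of_surjective fun (y : LL F ⊗[kBarT F] Module.Dual (kBarT F) P) => ?_
  refine ⟨∑ i, B.dualBasis.repr (P.daggerDual y) i ⊗ₜ ⟨ν i, hν i⟩, ?_⟩
  rw [map_sum]
  simp only [bettiComparison_tmul]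
  change ∑ i, B.dualBasis.repr (P.daggerDual y) i • ν i = y
  apply P.daggerDual.injective
  rw [map_sum]
  simp only [map_smul, ν, LinearEquiv.apply_symm_apply]
  exact B.dualBasis.sum_repr _

end PreTMotive

open PreTMotive Limits

variable {F : Type u} [Field F] [Fintype F]

/-! ### Rigid analytically trivial objects form a rigid abelian tensor category -/

instance : (isRAT F).IsClosedUnderSubobjects where
  prop_of_mono f _ hQ := by
    have hf : Function.Injective f.1 :=
      (ModuleCat.mono_iff_injective ((DiffModule.forgetful _ _).map f)).1 inferInstance
    exact isRAT_of_injective hQ hf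
      (DiffModule.function_exact_of_exact (ShortComplex.exact_cokernel f))

instance : (isRAT F).IsClosedUnderQuotients where
  prop_of_epi f _ hP :=
    isRAT_of_surjective_hom hP
      ((ModuleCat.epi_iff_surjective ((DiffModule.forgetful _ _).map f)).1 inferInstance)

instance : (isRAT F).IsMonoidal where
  prop_unit := isRAT_unit
  prop_tensor _ _ := isRAT_tensor

instance : (isRAT F).ContainsZero where
  exists_zero := ⟨DiffModule.zero _ _, DiffModule.isZero_zero, isRAT_of_surjective fun x => by
    refine ⟨0, ?_⟩
    have : Subsingleton (DiffModule.zero (kBarT F) (sigmaT F) : Type u) :=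
      inferInstanceAs (Subsingleton PUnit)
    exact Subsingleton.elim _ _⟩

instance : (isRAT F).IsClosedUnderBinaryProducts where
  limitsOfShape_le := by
    rintro X ⟨p⟩
    refine (isRAT F).prop_of_iso (IsLimit.conePointUniqueUpToIso
      (prodIsProd _ _) ((IsLimit.postcomposeHomEquiv (diagramIsoPair p.diag) _).2 p.isLimit)) ?_
    refine (isRAT F).prop_of_iso (biprod.isoProd _ _) ?_
    exact isRAT_of_total (p.prop_diag_obj _) (p.prop_diag_obj _) biprod.total

instance : (isRAT F).IsClosedUnderFiniteProducts := .mk'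

/-- The dual of a rigid analytically trivial object. -/
def ratDual (P : RATMotive F) : RATMotive F := ⟨DiffModule.dual P.obj, isRAT_dual P.property⟩

instance (P : RATMotive F) : ExactPairing P (ratDual P) where
  coevaluation' := ObjectProperty.homMk (DiffModule.coev P.obj)
  evaluation' := ObjectProperty.homMk (DiffModule.ev P.obj)
  coevaluation_evaluation' := ObjectProperty.hom_ext _
    (ExactPairing.coevaluation_evaluation' (X := P.obj) (Y := DiffModule.dual P.obj))
  evaluation_coevaluation' := ObjectProperty.hom_ext _
    (ExactPairing.evaluation_coevaluation' (X := P.obj) (Y := DiffModule.dual P.obj))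

/-- The scalar by which an endomorphism of the identity object acts. -/
def unitScalar (f : 𝟙_ (RATMotive F) ⟶ 𝟙_ (RATMotive F)) : kBarT F := f.hom.1 (1 : kBarT F)

theorem unitScalar_injective : Function.Injective (unitScalar (F := F)) := by
  intro f g h
  have hval (f : 𝟙_ (RATMotive F) ⟶ 𝟙_ (RATMotive F)) (x : kBarT F) :
      f.hom.1 x = x * unitScalar f :=
    (congrArg f.hom.1 (mul_one x).symm).trans (f.hom.1.map_smul x (1 : kBarT F))
  refine ObjectProperty.hom_ext _ (Subtype.ext (LinearMap.ext fun (x : kBarT F) => ?_))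
  exact (hval f x).trans ((congrArg (x * ·) h).trans (hval g x).symm)

theorem unitScalar_smul_id (c : RatFunc F) :
    unitScalar (c • 𝟙 (𝟙_ (RATMotive F))) = algebraMap (RatFunc F) (kBarT F) c :=
  mul_one (algebraMap (RatFunc F) (kBarT F) c)

theorem sigmaT_unitScalar (f : 𝟙_ (RATMotive F) ⟶ 𝟙_ (RATMotive F)) :
    sigmaT F (unitScalar f) = unitScalar f :=
  (f.hom.2 (1 : kBarT F)).symm.trans (congrArg f.hom.1 (map_one (sigmaT F)))

theorem smul_id_unit_bijective :
    Function.Bijective fun c : RatFunc F => c • 𝟙 (𝟙_ (RATMotive F)) := by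
  constructor
  · intro c d h
    apply (algebraMap (RatFunc F) (kBarT F)).injective
    rw [← unitScalar_smul_id, ← unitScalar_smul_id]
    exact congrArg unitScalar h
  · intro f
    obtain ⟨c, hc⟩ := exists_algebraMap_eq_of_sigmaT_eq (sigmaT_unitScalar f)
    exact ⟨c, unitScalar_injective ((unitScalar_smul_id c).trans hc)⟩

theorem isRigidAbelianTensor : IsRigidAbelianTensor (RatFunc F) (RATMotive F) where
  abelian := ⟨inferInstance, rfl⟩
  tensor_additive := inferInstance
  tensor_linear := inferInstance
  rigid :=
    have : RightRigidCategory (RATMotive F) :=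
      { rightDual := fun P => { rightDual := ratDual P } }
    ⟨BraidedCategory.rigidCategoryOfRightRigidCategory⟩
  end_unit := smul_id_unit_bijective

/-! ### `P ↦ P^B` as a tensor functor -/

namespace PreTMotive

theorem bettiTensor_whiskerRight {P Q : PreTMotive F} (f : P ⟶ Q) (T : PreTMotive F) :
    bettiTensor Q T ∘ₗ (bettiMap f).rTensor T.betti = bettiMap (f ▷ T) ∘ₗ bettiTensor P T :=
  TensorProduct.ext' fun x y => Subtype.ext <| Eq.symm <|
    (basePairing_map f.1 LinearMap.id x.1 y.1).trans <|
      congrArg (basePairing _ _ _ _ _) (LinearMap.congr_fun LinearMap.baseChange_id y.1)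

theorem bettiTensor_whiskerLeft {P Q : PreTMotive F} (T : PreTMotive F) (f : P ⟶ Q) :
    bettiTensor T Q ∘ₗ (bettiMap f).lTensor T.betti = bettiMap (T ◁ f) ∘ₗ bettiTensor T P :=
  TensorProduct.ext' fun x y => Subtype.ext <| Eq.symm <|
    (basePairing_map LinearMap.id f.1 x.1 y.1).trans <|
      congrArg (fun z => basePairing _ _ _ _ z _) (LinearMap.congr_fun LinearMap.baseChange_id x.1)

theorem bettiTensor_comm (P Q : PreTMotive F) :
    bettiMap (β_ P Q).hom ∘ₗ bettiTensor P Q =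
      bettiTensor Q P ∘ₗ (TensorProduct.comm (RatFunc F) P.betti Q.betti).toLinearMap :=
  TensorProduct.ext' fun x y => Subtype.ext (basePairing_comm x.1 y.1)

theorem bettiTensor_assoc (P Q T : PreTMotive F) :
    bettiMap (α_ P Q T).hom ∘ₗ bettiTensor (P ⊗ Q) T ∘ₗ (bettiTensor P Q).rTensor T.betti =
      bettiTensor P (Q ⊗ T) ∘ₗ (bettiTensor Q T).lTensor P.betti ∘ₗ
        (TensorProduct.assoc (RatFunc F) P.betti Q.betti T.betti).toLinearMap :=
  TensorProduct.ext_threefold fun x y z => Subtype.ext (basePairing_assoc x.1 y.1 z.1)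

theorem bettiTensor_leftUnitor (P : PreTMotive F) :
    bettiMap (λ_ P).hom ∘ₗ bettiTensor (𝟙_ _) P ∘ₗ (bettiUnit F).rTensor P.betti =
      (TensorProduct.lid (RatFunc F) P.betti).toLinearMap := by
  refine TensorProduct.ext' fun c x => Subtype.ext ?_
  refine Eq.trans ?_ ((basePairing_lid (algebraMap (RatFunc F) (LL F) c) x.1).trans
    (algebraMap_smul (LL F) c x.1))
  rw [← bettiUnit_eq_tmul]
  rfl

theorem bettiTensor_rightUnitor (P : PreTMotive F) :
    bettiMap (ρ_ P).hom ∘ₗ bettiTensor P (𝟙_ _) ∘ₗ (bettiUnit F).lTensor P.betti =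
      (TensorProduct.rid (RatFunc F) P.betti).toLinearMap := by
  refine TensorProduct.ext' fun x c => Subtype.ext ?_
  refine Eq.trans ?_ ((basePairing_rid (algebraMap (RatFunc F) (LL F) c) x.1).trans
    (algebraMap_smul (LL F) c x.1))
  rw [← bettiUnit_eq_tmul]
  rfl

end PreTMotive

/-- The isomorphism `𝔽_q(t) ≅ 1^B`. -/
def bettiFunctorUnitIso : 𝟙_ (FGModuleCat.{u} (RatFunc F)) ≅ (bettiFunctor F).obj (𝟙_ _) :=
  have := finite_betti (isRAT_unit (F := F))
  (LinearEquiv.ofBijective (bettiUnit F) bettiUnit_bijective).toFGModuleCatIso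

/-- The natural isomorphism `P^B ⊗ Q^B ≅ (P ⊗ Q)^B`. -/
def bettiFunctorTensorIso (P Q : RATMotive F) :
    (bettiFunctor F).obj P ⊗ (bettiFunctor F).obj Q ≅ (bettiFunctor F).obj (P ⊗ Q) :=
  have := finite_betti P.property
  have := finite_betti Q.property
  have := finite_betti (isRAT_tensor P.property Q.property)
  (LinearEquiv.ofBijective (bettiTensor P.obj Q.obj)
    (bettiTensor_bijective P.property Q.property)).toFGModuleCatIso

theorem FGModuleCat.hom_ext_linearMap {k : Type u} [Field k] {V W : FGModuleCat.{u} k} {f g : V ⟶ W}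
    (h : f.hom.hom = g.hom.hom) : f = g :=
  ObjectProperty.hom_ext _ (ModuleCat.hom_ext h)

/-- The tensor structure on `P ↦ P^B`. -/
def bettiFunctorCore : (bettiFunctor F).CoreMonoidal where
  εIso := bettiFunctorUnitIso
  μIso := bettiFunctorTensorIso
  μIso_hom_natural_left f T := FGModuleCat.hom_ext_linearMap <|
    bettiTensor_whiskerRight f.hom T.obj
  μIso_hom_natural_right T f := FGModuleCat.hom_ext_linearMap <|
    bettiTensor_whiskerLeft T.obj f.hom
  associativity P Q T := FGModuleCat.hom_ext_linearMap <|
    bettiTensor_assoc P.obj Q.obj T.obj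
  left_unitality P := FGModuleCat.hom_ext_linearMap <|
    (bettiTensor_leftUnitor P.obj).symm
  right_unitality P := FGModuleCat.hom_ext_linearMap <|
    (bettiTensor_rightUnitor P.obj).symm

instance : (bettiFunctor F).Monoidal := bettiFunctorCore.toMonoidal

instance : (bettiFunctor F).Braided where
  braided P Q := FGModuleCat.hom_ext_linearMap (bettiTensor_comm P.obj Q.obj)

/-! ### Exactness of `P ↦ P^B` -/

instance : (bettiFunctor F).Additive where
  map_add {_ _ f g} := FGModuleCat.hom_ext_linearMap <| LinearMap.ext fun x => Subtype.ext <|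
    LinearMap.congr_fun (LinearMap.baseChange_add (A := LL F) f.hom.1 g.hom.1) x.1

theorem bettiFunctor_map_exact {S : ShortComplex (RATMotive F)} (hS : S.Exact) :
    (S.map (bettiFunctor F)).Exact := by
  have : (isRAT F).ι.PreservesHomology :=
    ⟨(isRAT F).preservesKernels_ι, (isRAT F).preservesCokernels_ι⟩
  have h := bettiMap_exact S.X₁.property S.X₂.property
    (DiffModule.function_exact_of_exact (hS.map (isRAT F).ι))
  exact (ShortComplex.exact_map_iff_of_faithful _
    (forget₂ (FGModuleCat (RatFunc F)) (ModuleCat _))).1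
    ((ShortComplex.ShortExact.moduleCat_exact_iff_function_exact _).2 h)

theorem isFiberFunctor : IsFiberFunctor (RatFunc F) (bettiFunctor F) := by
  have hex := ((bettiFunctor F).exact_tfae.out 1 3).1 fun S hS => bettiFunctor_map_exact hS
  exact
  { additive := inferInstance
    linear := ⟨fun f c => FGModuleCat.hom_ext_linearMap <| LinearMap.ext fun x =>
      Subtype.ext <|
        (LinearMap.congr_fun (LinearMap.baseChange_smul (A := LL F)
          (algebraMap (RatFunc F) (kBarT F) c) f.hom.1) x.1).trans
        (algebraMap_smul (kBarT F) c (f.hom.1.baseChange (LL F) x.1))⟩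
    faithful := ⟨fun {P _ _ _} h => ObjectProperty.hom_ext _ <| bettiMap_injective P.property <|
      congrArg (fun φ => φ.hom.hom) h⟩
    left_exact := hex.1
    right_exact := hex.2 }

end TMotive

end

theorem mainTheorem9 (F : Type u) [Field F] [Fintype F] :
    -- `ℛ` contains the identity object and is closed under tensor products in `𝒫`
    ∃ _ : (TMotive.PreTMotive.isRAT F).IsMonoidal,
      TMotive.IsRigidAbelianTensor (RatFunc F) (TMotive.RATMotive F) ∧
      -- `P ↦ P^B` is a tensor functor, through the natural maps `P^B ⊗ Q^B → (P ⊗ Q)^B`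
      ∃ _ : (TMotive.bettiFunctor F).Braided,
        TMotive.IsFiberFunctor (RatFunc F) (TMotive.bettiFunctor F) ∧
        ∀ (P Q : TMotive.RATMotive F) (x : P.obj.betti) (y : Q.obj.betti),
          ((Functor.LaxMonoidal.μ (TMotive.bettiFunctor F) P Q).hom.hom (x ⊗ₜ[RatFunc F] y) :
            (P ⊗ Q).obj.betti).1 = TMotive.PreTMotive.daggerTensor x.1 y.1 :=
  ⟨inferInstance, TMotive.isRigidAbelianTensor, inferInstance, TMotive.isFiberFunctor,
    fun _ _ => TMotive.PreTMotive.bettiTensor_tmul⟩
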